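/- All graphs are finite, simple and undirected. A monophonic path in a graph $G$ is an induced path, i.e. a path without chords. A set $S$ of vertices of $G$ is in monophonic position if no monophonic path of $G$ contains more than two elements of $S$, and the mp-number of $G$ is the largest size of a set of vertices in monophonic position. For $n \ge a \ge 2$ let $\mathrm{mex}(n;a)$ be the largest number of edges of a graph with $n$ vertices and mp-number $a$. Let $T^*_{n,2}$ be the graph obtained from the complete bipartite graph with partite sets $\{u_{1,j} : 1 \le j \le \lceil n/2\rceil\}$ and $\{u_{2,j} : 1 \le j \le \lfloor n/2\rfloor\}$ by deleting the edges $u_{1,j}u_{2,j}$ for $1 \le j \le \lfloor n/2\rfloor$. **Theorem.** For every $n \ge 6$, $$\mathrm{mex}(n;2) = \left\lceil \frac{(n-1)^2}{4} \right\rceil .$$ If $n$ is odd, then, up to isomorphism, $T^*_{n,2}$ (that is, $K_{r+1,r}$ minus a matching of size $r$, where $n = 2r+1$) is the unique graph with $n$ vertices, mp-number $2$ and $\mathrm{mex}(n;2)$ edges. If $n$ is even, then, up to isomorphism, the unique such graph is $T^*_{n,2}$ with one (arbitrary) missing edge between the two partite sets added (that is, $K_{r,r}$ minus a matching of size $r-1$,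 where $n = 2r$). -/

import Mathlib

namespace MonoPos

open SimpleGraph

/-- A monophonic path: a path without chords, i.e. an induced path. -/
def IsMonophonic {V : Type*} {G : SimpleGraph V} {u v : V} (p : G.Walk u v) : Prop :=
  p.IsPath ∧ p.IsChordless

/-- `S` is in monophonic position: no monophonic path contains more than two elements of `S`. -/
def InMonophonicPosition {V : Type*} (G : SimpleGraph V) (S : Finset V) : Prop :=
  ∀ (u v : V) (p : G.Walk u v), IsMonophonic p → {x | x ∈ S ∧ x ∈ p.support}.ncard ≤ 2

/-- The monophonic position number of a graph (used for finite graphs only, where it is a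
maximum): the largest size of a set of vertices in monophonic position. -/
noncomputable def mpNumber {V : Type*} (G : SimpleGraph V) : ℕ :=
  sSup {k | ∃ S : Finset V, InMonophonicPosition G S ∧ S.card = k}

/-- The sizes (numbers of edges) of the graphs with order `n` and mp-number `a`. -/
def mpSizes (n a : ℕ) : Set ℕ :=
  {m | ∃ G : SimpleGraph (Fin n), mpNumber G = a ∧ G.edgeSet.ncard = m}

/-- `mex(n; a)`: the largest size of a graph with order `n` and mp-number `a`. -/
noncomputable def mex (n a : ℕ) : ℕ := sSup (mpSizes n a)

/-- A graph with mp-number `a` and the largest possible size among the graphs with the same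
order and mp-number `a`. -/
def IsMexExtremal {V : Type*} (G : SimpleGraph V) (a : ℕ) : Prop :=
  mpNumber G = a ∧ G.edgeSet.ncard = mex (Nat.card V) a

/-- The graph `T*_{n,a}`. In the Turán graph `turanGraph n a` the partite sets are the residue
classes modulo `a`; the vertex `v` is the element with index `v / a` of the class of `v % a`.
For every index `j < ⌊n / a⌋` the edges of the `a`-clique formed by the vertices of index `j`
are deleted. -/
def tStar (n a : ℕ) : SimpleGraph (Fin n) where
  Adj v w := (turanGraph n a).Adj v w ∧ ¬ (v.val / a = w.val / a ∧ v.val / a < n / a)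
  symm := ⟨fun v w h => ⟨h.1.symm, fun h' => h.2 ⟨h'.1.symm, h'.1 ▸ h'.2⟩⟩⟩
  loopless := ⟨fun v h => (turanGraph n a).loopless.irrefl v h.1⟩

/-- `v` and `w` lie in different partite sets of `T*_{n,a}` and are not joined in it, so that
`vw` is an edge that can be added between the partite sets. -/
def IsNewCrossEdge (n a : ℕ) (v w : Fin n) : Prop :=
  (turanGraph n a).Adj v w ∧ ¬ (tStar n a).Adj v w

end MonoPos

/-!
A graph on at least two vertices has mp-number two exactly when every three vertices lie on a
common induced path (`mpNumber_eq_two_iff`). Such a graph is triangle-free, and among three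
pairwise non-adjacent vertices two have incomparable neighbourhoods: the first and the last one on
the path (`TriplesOnMonophonic.incomparable`).

In a bipartite graph, a vertex adjacent to the whole other class has a neighbourhood comparable
with that of every vertex of its own class. So a class with at least three vertices has at most one
such vertex, and at least `a - 1` edges are missing, where `a` is the size of the larger class. This
bounds the number of edges by `a(b-1)+1`, and `4(a(b-1)+1) ≥ (a+b-1)²` forces `a - b ≤ 1` and
exactly `a - 1` missing edges. These form a matching, as two vertices missing the same edge end
would be twins (`TriplesOnMonophonic.isNearCompleteBipartite`). Conversely these near-complete
bipartite graphs have mp-number two, and they are determined by the number of vertices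
(`IsNearCompleteBipartite.triplesOnMonophonic`, `IsNearCompleteBipartite.nonempty_iso`).

It remains to exclude non-bipartite graphs with `(n-1)²/4` edges or more
(`TriplesOnMonophonic.colorable_two`). Every vertex has at most two neighbours on a shortest odd
closed walk, so if its length is `l`, then Mantel's theorem for the `m = n - l` other vertices gives
at most `l + 2m + m²/4` edges (`two_mul_ncard_edgeSet_eq`). This is less than `(n-1)²/4` for
`l ≥ 7`. For `l = 5` it exceeds `(n-1)²/4` by one, so at most one edge can be spared
(`exists_five_cycle`). If all outer vertices have two neighbours on the five-cycle `f`, each of them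
has the neighbours of some `f i` on the cycle, and so its neighbourhood is contained in that of
`f i`. Induced paths through two such vertices are very restricted
(`TriplesOnMonophonic.path_of_neighbors_subset`), which makes every outer vertex miss a vertex of a
neighbouring type; that costs more than one edge if `m ≥ 3`, while for `m = 2` the two outer
vertices cannot miss each other consistently (`false_of_forall_isType`, `isType_eq_add_one`).
Otherwise exactly one outer vertex has a single neighbour on the cycle and the outer vertices span
a balanced complete bipartite graph, in which the same restriction gives a contradiction
(`IsExceptional.false`).
-/

namespace MonoPos

open SimpleGraph

/-! ### Monophonic paths through three vertices -/

/-- Every three distinct vertices of `G` lie on a common monophonic path. -/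
def TriplesOnMonophonic {V : Type*} (G : SimpleGraph V) : Prop :=
  ∀ x y z : V, x ≠ y → y ≠ z → x ≠ z →
    ∃ (u v : V) (p : G.Walk u v), IsMonophonic p ∧ x ∈ p.support ∧ y ∈ p.support ∧ z ∈ p.support

lemma inMonophonicPosition_of_card_le_two {V : Type*} (G : SimpleGraph V) {S : Finset V}
    (hS : S.card ≤ 2) : InMonophonicPosition G S := by
  intro u v p _
  refine le_trans ?_ hS
  rw [← Set.ncard_coe_finset]
  exact Set.ncard_le_ncard (fun x hx => hx.1) S.finite_toSet

lemma InMonophonicPosition.card_le_two {V : Type*} {G : SimpleGraph V} {S : Finset V}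
    (hG : TriplesOnMonophonic G) (hS : InMonophonicPosition G S) : S.card ≤ 2 := by
  classical
  by_contra! h
  obtain ⟨x, y, z, hx, hy, hz, hxy, hxz, hyz⟩ := Finset.two_lt_card_iff.1 h
  obtain ⟨u, v, p, hp, h1, h2, h3⟩ := hG x y z hxy hyz hxz
  have hle := hS u v p hp
  have hsub : (↑({x, y, z} : Finset V) : Set V) ⊆ {x | x ∈ S ∧ x ∈ p.support} := by
    intro a ha
    simp only [Finset.coe_insert, Finset.coe_singleton, Set.mem_insert_iff,
      Set.mem_singleton_iff] at ha
    rcases ha with rfl | rfl | rfl <;> exact ⟨‹_›, ‹_›⟩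
  have hfin : {x | x ∈ S ∧ x ∈ p.support}.Finite := S.finite_toSet.subset fun x hx => hx.1
  have h3 := Set.ncard_le_ncard hsub hfin
  rw [Set.ncard_coe_finset, Finset.card_eq_three.2 ⟨x, y, z, hxy, hxz, hyz, rfl⟩] at h3
  omega

/-- Since subsets of sets in monophonic position are again in monophonic position, having
mp-number two is a condition on triples of vertices. -/
theorem mpNumber_eq_two_iff {V : Type*} [Fintype V] (G : SimpleGraph V)
    (hV : 2 ≤ Fintype.card V) : mpNumber G = 2 ↔ TriplesOnMonophonic G := by
  classical
  have hbdd : BddAbove {k | ∃ S : Finset V, InMonophonicPosition G S ∧ S.card = k} := by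
    refine ⟨Fintype.card V, ?_⟩
    rintro k ⟨S, -, rfl⟩
    exact S.card_le_univ
  constructor
  · intro h x y z hxy hyz hxz
    have hnot : ¬ InMonophonicPosition G {x, y, z} := by
      intro hS
      have : ({x, y, z} : Finset V).card ≤ mpNumber G := le_csSup hbdd ⟨_, hS, rfl⟩
      rw [Finset.card_eq_three.2 ⟨x, y, z, hxy, hxz, hyz, rfl⟩] at this
      omega
    simp only [InMonophonicPosition, not_forall] at hnot
    obtain ⟨u, v, p, hp, hcard⟩ := hnot
    have hset : {a | a ∈ ({x, y, z} : Finset V) ∧ a ∈ p.support} =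
        ↑(({x, y, z} : Finset V).filter (· ∈ p.support)) := by
      ext a; simp
    rw [hset, Set.ncard_coe_finset, not_le] at hcard
    have heq : ({x, y, z} : Finset V).filter (· ∈ p.support) = {x, y, z} :=
      Finset.eq_of_subset_of_card_le (Finset.filter_subset _ _)
        (le_trans Finset.card_le_three hcard)
    rw [Finset.filter_eq_self] at heq
    exact ⟨u, v, p, hp, heq x (by simp), heq y (by simp), heq z (by simp)⟩
  · intro h
    refine le_antisymm (csSup_le' ?_) ?_
    · rintro k ⟨S, hS, rfl⟩
      exact hS.card_le_two h
    · obtain ⟨S, -, hS⟩ := Finset.exists_subset_card_eq (s := (Finset.univ : Finset V)) (n := 2)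
        (by simpa using hV)
      exact le_csSup hbdd ⟨S, inMonophonicPosition_of_card_le_two G hS.le, hS⟩

/-- `s 0, …, s L` are the consecutive vertices of an induced path of `G`. -/
structure IsInducedSeq {V : Type*} (G : SimpleGraph V) (L : ℕ) (s : ℕ → V) : Prop where
  inj : ∀ i j, i ≤ L → j ≤ L → s i = s j → i = j
  adj_iff : ∀ i j, i ≤ L → j ≤ L → (G.Adj (s i) (s j) ↔ i + 1 = j ∨ j + 1 = i)

lemma IsInducedSeq.reverse {V : Type*} {G : SimpleGraph V} {L : ℕ} {s : ℕ → V}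
    (h : IsInducedSeq G L s) : IsInducedSeq G L (fun i => s (L - i)) where
  inj i j hi hj hij := by
    have := h.inj (L - i) (L - j) (by omega) (by omega) hij
    omega
  adj_iff i j hi hj := by
    rw [h.adj_iff (L - i) (L - j) (by omega) (by omega)]
    omega

lemma IsMonophonic.isInducedSeq {V : Type*} {G : SimpleGraph V} {u v : V} {p : G.Walk u v}
    (hp : IsMonophonic p) : IsInducedSeq G p.length p.getVert where
  inj i j hi hj hij := hp.1.getVert_injOn hi hj hij
  adj_iff i j hi hj := by
    constructor
    · intro hadj
      have := hp.2.mem_edges (p.getVert_mem_support i) (p.getVert_mem_support j) hadj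
      rw [Walk.mk_mem_edges_iff_exists] at this
      obtain ⟨k, hk, h⟩ := this
      rcases Sym2.eq_iff.1 h with ⟨h1, h2⟩ | ⟨h1, h2⟩
      · have a := hp.1.getVert_injOn (show k ≤ _ by omega) hi h1
        have b := hp.1.getVert_injOn (show k + 1 ≤ _ by omega) hj h2
        omega
      · have a := hp.1.getVert_injOn (show k ≤ _ by omega) hj h1
        have b := hp.1.getVert_injOn (show k + 1 ≤ _ by omega) hi h2
        omega
    · rintro (rfl | rfl)
      · exact p.adj_getVert_succ (by omega)
      · exact (p.adj_getVert_succ (by omega)).symm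

lemma TriplesOnMonophonic.exists_isInducedSeq {V : Type*} {G : SimpleGraph V}
    (hG : TriplesOnMonophonic G) {x y z : V} (hxy : x ≠ y) (hyz : y ≠ z) (hxz : x ≠ z) :
    ∃ L s, IsInducedSeq G L s ∧
      ∃ i ≤ L, ∃ j ≤ L, ∃ k ≤ L, s i = x ∧ s j = y ∧ s k = z := by
  obtain ⟨u, v, p, hp, hx, hy, hz⟩ := hG x y z hxy hyz hxz
  obtain ⟨i, rfl, hi⟩ := Walk.mem_support_iff_exists_getVert.1 hx
  obtain ⟨j, rfl, hj⟩ := Walk.mem_support_iff_exists_getVert.1 hy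
  obtain ⟨k, rfl, hk⟩ := Walk.mem_support_iff_exists_getVert.1 hz
  exact ⟨_, _, hp.isInducedSeq, i, hi, j, hj, k, hk, rfl, rfl, rfl⟩

/-- Three vertices of a triangle never share an induced path. -/
lemma TriplesOnMonophonic.cliqueFree_three {V : Type*} {G : SimpleGraph V}
    (hG : TriplesOnMonophonic G) : ∀ x y z, G.Adj x y → G.Adj y z → ¬ G.Adj x z := by
  intro x y z hxy hyz hxz
  obtain ⟨L, s, hs, i, hi, j, hj, k, hk, rfl, rfl, rfl⟩ :=
    hG.exists_isInducedSeq hxy.ne hyz.ne hxz.ne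
  rw [hs.adj_iff _ _ hi hj] at hxy
  rw [hs.adj_iff _ _ hj hk] at hyz
  rw [hs.adj_iff _ _ hi hk] at hxz
  omega

/-- On an induced path through three pairwise non-adjacent vertices, the two outer ones have
incomparable neighbourhoods. -/
lemma IsInducedSeq.incomparable {V : Type*} {G : SimpleGraph V} {L : ℕ} {s : ℕ → V}
    (hs : IsInducedSeq G L s) {i j k : ℕ} (hij : i + 2 ≤ j) (hjk : j + 2 ≤ k) (hk : k ≤ L) :
    (∃ p, G.Adj p (s i) ∧ ¬ G.Adj p (s k)) ∧ (∃ q, G.Adj q (s k) ∧ ¬ G.Adj q (s i)) := by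
  refine ⟨⟨s (i + 1), ?_, ?_⟩, ⟨s (k - 1), ?_, ?_⟩⟩ <;>
    rw [hs.adj_iff _ _ (by omega) (by omega)] <;> omega

/-- Among three pairwise non-adjacent vertices, two have incomparable neighbourhoods. -/
lemma TriplesOnMonophonic.incomparable {V : Type*} {G : SimpleGraph V}
    (hG : TriplesOnMonophonic G) {x y z : V} (hxy : x ≠ y) (hyz : y ≠ z) (hxz : x ≠ z)
    (axy : ¬ G.Adj x y) (ayz : ¬ G.Adj y z) (axz : ¬ G.Adj x z) :
    ((∃ p, G.Adj p x ∧ ¬ G.Adj p y) ∧ (∃ q, G.Adj q y ∧ ¬ G.Adj q x)) ∨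
    ((∃ p, G.Adj p y ∧ ¬ G.Adj p z) ∧ (∃ q, G.Adj q z ∧ ¬ G.Adj q y)) ∨
    ((∃ p, G.Adj p x ∧ ¬ G.Adj p z) ∧ (∃ q, G.Adj q z ∧ ¬ G.Adj q x)) := by
  obtain ⟨L, s, hs, i, hi, j, hj, k, hk, rfl, rfl, rfl⟩ := hG.exists_isInducedSeq hxy hyz hxz
  have nij : i ≠ j := fun h => hxy (h ▸ rfl)
  have njk : j ≠ k := fun h => hyz (h ▸ rfl)
  have nik : i ≠ k := fun h => hxz (h ▸ rfl)
  rw [hs.adj_iff _ _ hi hj] at axy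
  rw [hs.adj_iff _ _ hj hk] at ayz
  rw [hs.adj_iff _ _ hi hk] at axz
  rcases lt_trichotomy i j with h1 | h1 | h1
  · rcases lt_trichotomy j k with h2 | h2 | h2
    · exact Or.inr (Or.inr (hs.incomparable (j := j) (by omega) (by omega) hk))
    · omega
    · rcases lt_trichotomy i k with h3 | h3 | h3
      · exact Or.inl (hs.incomparable (j := k) (by omega) (by omega) hj)
      · omega
      · exact Or.inr (Or.inl (hs.incomparable (j := i) (by omega) (by omega) hj).symm)
  · omega
  · rcases lt_trichotomy j k with h2 | h2 | h2
    · rcases lt_trichotomy i k with h3 | h3 | h3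
      · exact Or.inr (Or.inl (hs.incomparable (j := i) (by omega) (by omega) hk))
      · omega
      · exact Or.inl (hs.incomparable (j := k) (by omega) (by omega) hi).symm
    · omega
    · exact Or.inr (Or.inr (hs.incomparable (j := j) (by omega) (by omega) hi).symm)

/-- The shape of an induced path through `w`, `v`, `z` when every neighbour of `w` is a neighbour of
`v` (so that `w` and `v` are not adjacent) and `z` is not adjacent to `w`: it starts at `w` with
`w, p, v, q, …` and ends at `z` or runs on through `z`; either `q = z`, or there is a further vertex
`r` after `q`. -/
lemma TriplesOnMonophonic.path_of_neighbors_subset {V : Type*} {G : SimpleGraph V}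
    (hG : TriplesOnMonophonic G) {w v z : V} (hwv : w ≠ v) (hvz : v ≠ z) (hwz : w ≠ z)
    (awz : ¬ G.Adj w z) (hsub : ∀ x, G.Adj w x → G.Adj v x) :
    ∃ p q, G.Adj w p ∧ G.Adj v q ∧ ¬ G.Adj w q ∧ q ≠ w ∧ (q = z ∨
      (¬ G.Adj p z ∧ ∃ r, G.Adj q r ∧ r ≠ v ∧ ¬ G.Adj p r)) := by
  obtain ⟨L, s, hs, i, hi, j, hj, k, hk, hw, hv, hz⟩ := hG.exists_isInducedSeq hwv hvz hwz
  -- `w` is an end of the path, since both path neighbours of `w` would be neighbours of `v`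
  have hend : i = 0 ∨ i = L := by
    by_contra! h
    have h1 := hsub (s (i - 1)) (by rw [← hw, hs.adj_iff _ _ (by omega) (by omega)]; omega)
    have h2 := hsub (s (i + 1)) (by rw [← hw, hs.adj_iff _ _ (by omega) (by omega)]; omega)
    rw [← hv, hs.adj_iff _ _ (by omega) (by omega)] at h1 h2
    have : i = j := by omega
    exact hwv (by rw [← hw, ← hv, this])
  wlog h0 : i = 0 generalizing s i j k
  · refine this _ hs.reverse (L - i) (by omega) (L - j) (by omega) (L - k) (by omega)
      ?_ ?_ ?_ ?_ (by omega)
    · rw [← hw]; congr 1; omega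
    · rw [← hv]; congr 1; omega
    · rw [← hz]; congr 1; omega
    · omega
  subst h0
  have nj : j ≠ 0 := fun h => hwv (by rw [← hw, ← hv, h])
  have nk : k ≠ 0 := fun h => hwz (by rw [← hw, ← hz, h])
  have njk : j ≠ k := fun h => hvz (by rw [← hv, ← hz, h])
  have hj2 : j = 2 := by
    have h1 := hsub (s 1) (by rw [← hw, hs.adj_iff _ _ (by omega) (by omega)]; omega)
    rw [← hv, hs.adj_iff _ _ (by omega) (by omega)] at h1
    omega
  subst hj2
  rw [← hw, ← hz, hs.adj_iff _ _ hi hk] at awz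
  have hk3 : 3 ≤ k := by omega
  subst hw hv
  refine ⟨s 1, s 3, ?_, ?_, ?_, ?_, ?_⟩
  · rw [hs.adj_iff _ _ (by omega) (by omega)]; omega
  · rw [hs.adj_iff _ _ (by omega) (by omega)]; omega
  · rw [hs.adj_iff _ _ (by omega) (by omega)]; omega
  · intro h
    have := hs.inj _ _ (by omega) (by omega) h
    omega
  · rcases Nat.lt_or_ge 3 k with h | h
    · right
      subst hz
      refine ⟨?_, s 4, ?_, ?_, ?_⟩
      · rw [hs.adj_iff _ _ (by omega) (by omega)]; omega
      · rw [hs.adj_iff _ _ (by omega) (by omega)]; omega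
      · intro h
        have := hs.inj _ _ (by omega) (by omega) h
        omega
      · rw [hs.adj_iff _ _ (by omega) (by omega)]; omega
    · left
      rw [← hz]; congr 1; omega

lemma exists_isMonophonic_three {V : Type*} {G : SimpleGraph V} {a b c : V} (hac : a ≠ c)
    (hab : G.Adj a b) (hbc : G.Adj b c) (nac : ¬ G.Adj a c) :
    ∃ (u v : V) (p : G.Walk u v), IsMonophonic p ∧ p.support = [a, b, c] := by
  refine ⟨a, c, .cons hab (.cons hbc .nil), ⟨?_, ?_⟩, by simp⟩
  · simp [Walk.cons_isPath_iff, hab.ne, hbc.ne, hac]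
  · rw [Walk.isChordless_iff_forall_mem_edges]
    intro x y hx hy hxy
    have := hxy.symm
    simp only [Walk.support_cons, Walk.support_nil, List.mem_cons, List.not_mem_nil,
      or_false] at hx hy
    simp only [Walk.edges_cons, Walk.edges_nil, List.mem_cons, Sym2.eq_iff]
    rcases hx with rfl | rfl | rfl <;> rcases hy with rfl | rfl | rfl <;> simp_all

lemma exists_isMonophonic_four {V : Type*} {G : SimpleGraph V} {a b c d : V} (hac : a ≠ c)
    (hbd : b ≠ d) (had : a ≠ d) (hab : G.Adj a b) (hbc : G.Adj b c) (hcd : G.Adj c d)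
    (nac : ¬ G.Adj a c) (nbd : ¬ G.Adj b d) (nad : ¬ G.Adj a d) :
    ∃ (u v : V) (p : G.Walk u v), IsMonophonic p ∧ p.support = [a, b, c, d] := by
  refine ⟨a, d, .cons hab (.cons hbc (.cons hcd .nil)), ⟨?_, ?_⟩, by simp⟩
  · simp [Walk.cons_isPath_iff, hab.ne, hbc.ne, hcd.ne, hac, hbd, had]
  · rw [Walk.isChordless_iff_forall_mem_edges]
    intro x y hx hy hxy
    have := hxy.symm
    simp only [Walk.support_cons, Walk.support_nil, List.mem_cons, List.not_mem_nil,
      or_false] at hx hy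
    simp only [Walk.edges_cons, Walk.edges_nil, List.mem_cons, Sym2.eq_iff]
    rcases hx with rfl | rfl | rfl | rfl <;> rcases hy with rfl | rfl | rfl | rfl <;> simp_all

lemma exists_isMonophonic_five {V : Type*} {G : SimpleGraph V} {a b c d e : V} (hac : a ≠ c)
    (hbd : b ≠ d) (had : a ≠ d) (hae : a ≠ e) (hbe : b ≠ e) (hce : c ≠ e)
    (hab : G.Adj a b) (hbc : G.Adj b c) (hcd : G.Adj c d) (hde : G.Adj d e)
    (nac : ¬ G.Adj a c) (nbd : ¬ G.Adj b d) (nad : ¬ G.Adj a d)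
    (nae : ¬ G.Adj a e) (nbe : ¬ G.Adj b e) (nce : ¬ G.Adj c e) :
    ∃ (u v : V) (p : G.Walk u v), IsMonophonic p ∧ p.support = [a, b, c, d, e] := by
  refine ⟨a, e, .cons hab (.cons hbc (.cons hcd (.cons hde .nil))), ⟨?_, ?_⟩, by simp⟩
  · simp [Walk.cons_isPath_iff, hab.ne, hbc.ne, hcd.ne, hde.ne, hac, hbd, had, hae, hbe, hce]
  · rw [Walk.isChordless_iff_forall_mem_edges]
    intro x y hx hy hxy
    have := hxy.symm
    simp only [Walk.support_cons, Walk.support_nil, List.mem_cons, List.not_mem_nil,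
      or_false] at hx hy
    simp only [Walk.edges_cons, Walk.edges_nil, List.mem_cons, Sym2.eq_iff]
    rcases hx with rfl | rfl | rfl | rfl | rfl <;>
      rcases hy with rfl | rfl | rfl | rfl | rfl <;> simp_all

/-! ### Bipartite graphs: counting missing cross edges -/

/-- For a two-colouring `c`, the vertex `v` is adjacent to every vertex of the other colour. -/
def IsFull {V : Type*} (G : SimpleGraph V) (c : V → Bool) (v : V) : Prop :=
  ∀ w, c w ≠ c v → G.Adj v w

/-- `G` is a complete bipartite graph with colour classes of sizes `⌈n/2⌉` (colour `false`) and
`⌊n/2⌋` (colour `true`), minus a matching that covers all but one of the vertices of colour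
`false` and all but at most one of the vertices of colour `true`. These are the extremal graphs. -/
structure IsNearCompleteBipartite {V : Type*} [Fintype V] (G : SimpleGraph V) (c : V → Bool) :
    Prop where
  proper : ∀ u v, G.Adj u v → c u ≠ c v
  eq_of_not_adj : ∀ u v w, c v ≠ c u → c w ≠ c u → ¬ G.Adj u v → ¬ G.Adj u w → v = w
  eq_of_isFull : ∀ u v, c u = c v → IsFull G c u → IsFull G c v → u = v
  exists_isFull : ∃ u, c u = false ∧ IsFull G c u
  card : (Finset.univ.filter (c · = false)).card = (Finset.univ.filter (c · = true)).card ∨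
    (Finset.univ.filter (c · = false)).card = (Finset.univ.filter (c · = true)).card + 1

lemma card_false_add_card_true {V : Type*} [Fintype V] (c : V → Bool) :
    (Finset.univ.filter (c · = false)).card + (Finset.univ.filter (c · = true)).card =
      Fintype.card V := by
  have := Finset.card_filter_add_card_filter_not (s := (Finset.univ : Finset V)) (c · = false)
  simpa using this

open Classical in
/-- The vertices of colour `true` that are not adjacent to `v`. -/
noncomputable def missing {V : Type*} [Fintype V] (G : SimpleGraph V) (c : V → Bool) (v : V) :
    Finset V :=
  Finset.univ.filter fun w => c w = true ∧ ¬ G.Adj v w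

lemma mem_missing {V : Type*} [Fintype V] {G : SimpleGraph V} {c : V → Bool} {v w : V} :
    w ∈ missing G c v ↔ c w = true ∧ ¬ G.Adj v w := by
  simp [missing]

lemma isFull_iff_card_missing {V : Type*} [Fintype V] {G : SimpleGraph V} {c : V → Bool} {v : V}
    (hv : c v = false) : IsFull G c v ↔ (missing G c v).card = 0 := by
  rw [Finset.card_eq_zero, Finset.eq_empty_iff_forall_notMem]
  simp [IsFull, mem_missing, hv]

lemma ncard_edgeSet_add_sum_missing {V : Type*} [Fintype V] {G : SimpleGraph V} {c : V → Bool}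
    (hc : ∀ u v, G.Adj u v → c u ≠ c v) :
    G.edgeSet.ncard + ∑ v ∈ Finset.univ.filter (c · = false), (missing G c v).card =
      (Finset.univ.filter (c · = false)).card * (Finset.univ.filter (c · = true)).card := by
  classical
  have hb : G.IsBipartiteWith ↑(Finset.univ.filter (c · = false))
      ↑(Finset.univ.filter (c · = true)) := by
    refine ⟨?_, ?_⟩
    · rw [Finset.disjoint_coe, Finset.disjoint_filter]
      intro x _ h; simp [h]
    · intro v w hvw
      have := hc v w hvw
      simp only [Finset.coe_filter, Finset.mem_univ, true_and, Set.mem_ofPred_eq]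
      revert this
      cases c v <;> cases c w <;> simp
  have he : G.edgeSet.ncard = G.edgeFinset.card := by
    rw [← coe_edgeFinset, Set.ncard_coe_finset]
  rw [he, ← isBipartiteWith_sum_degrees_eq_card_edges hb, ← Finset.sum_add_distrib]
  rw [Finset.sum_const_nat]
  intro v hv
  simp only [Finset.mem_filter, Finset.mem_univ, true_and] at hv
  rw [← card_neighborFinset_eq_degree, ← Finset.card_union_of_disjoint]
  · congr 1
    ext w
    simp only [Finset.mem_union, mem_neighborFinset, mem_missing, Finset.mem_filter,
      Finset.mem_univ, true_and]
    constructor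
    · rintro (h | h)
      · have := hc v w h
        revert this; simp [hv]
      · exact h.1
    · intro h
      by_cases hvw : G.Adj v w
      · exact Or.inl hvw
      · exact Or.inr ⟨h, hvw⟩
  · rw [Finset.disjoint_left]
    intro w hw
    simp only [mem_neighborFinset] at hw
    simp [mem_missing, hw]

/-- A full vertex has a neighbourhood comparable to that of every vertex of its colour, so two full
vertices of one colour cannot be accompanied by a third vertex of that colour. -/
lemma TriplesOnMonophonic.eq_of_isFull {V : Type*} [Fintype V] {G : SimpleGraph V} {c : V → Bool}
    (hG : TriplesOnMonophonic G) (hc : ∀ u v, G.Adj u v → c u ≠ c v) {b : Bool}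
    (hb : 3 ≤ (Finset.univ.filter (c · = b)).card) {u v : V} (hu : c u = b) (hv : c v = b)
    (fu : IsFull G c u) (fv : IsFull G c v) : u = v := by
  classical
  by_contra huv
  obtain ⟨z, hz, hzn⟩ := Finset.exists_mem_notMem_of_card_lt_card
    (s := {u, v}) (t := Finset.univ.filter (c · = b)) (lt_of_le_of_lt Finset.card_le_two hb)
  simp only [Finset.mem_filter, Finset.mem_univ, true_and, Finset.mem_insert,
    Finset.mem_singleton, not_or] at hz hzn
  have full_adj : ∀ x y p, IsFull G c x → c x = b → c y = b → G.Adj p y → G.Adj p x := by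
    intro x y p hx hxb hyb hpy
    exact (hx p (by rw [hxb, ← hyb]; exact hc _ _ hpy)).symm
  have nadj : ∀ x y, c x = b → c y = b → ¬ G.Adj x y := fun x y hx hy h =>
    hc _ _ h (hx.trans hy.symm)
  rcases hG.incomparable huv (Ne.symm hzn.2) (Ne.symm hzn.1) (nadj _ _ hu hv) (nadj _ _ hv hz)
    (nadj _ _ hu hz) with ⟨⟨p, hp, hp'⟩, -⟩ | ⟨-, q, hq, hq'⟩ | ⟨-, q, hq, hq'⟩
  · exact hp' (full_adj _ _ _ fv hv hu hp)
  · exact hq' (full_adj _ _ _ fv hv hz hq)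
  · exact hq' (full_adj _ _ _ fu hu hz hq)

/-- A bipartite graph of the required size with mp-number two is near-complete bipartite: all but
one of the vertices of the larger class have a missing edge, and this already uses up all edges
that may be missing. -/
theorem TriplesOnMonophonic.isNearCompleteBipartite {V : Type*} [Fintype V] {G : SimpleGraph V}
    {c : V → Bool} (hG : TriplesOnMonophonic G) (hn : 6 ≤ Fintype.card V)
    (hc : ∀ u v, G.Adj u v → c u ≠ c v)
    (hle : (Finset.univ.filter (c · = true)).card ≤ (Finset.univ.filter (c · = false)).card)
    (he : (Fintype.card V - 1) ^ 2 ≤ 4 * G.edgeSet.ncard) : IsNearCompleteBipartite G c := by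
  classical
  have hsum := ncard_edgeSet_add_sum_missing hc
  have hcard := card_false_add_card_true c
  have hfull : ∀ u v, c u = false → c v = false → IsFull G c u → IsFull G c v → u = v :=
    fun u v hu hv => hG.eq_of_isFull hc (by omega) hu hv
  -- all but at most one of the vertices of colour `false` have a missing edge
  have hex : ∃ t : V, ∀ u, c u = false → u ≠ t → 1 ≤ (missing G c u).card := by
    by_cases h : ∃ t, c t = false ∧ IsFull G c t
    · obtain ⟨t, ht, ft⟩ := h
      refine ⟨t, fun u hu hut => ?_⟩
      by_contra! h0
      exact hut (hfull _ _ hu ht ((isFull_iff_card_missing hu).2 (by omega)) ft)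
    · push Not at h
      have : Nonempty V := Fintype.card_pos_iff.1 (by omega)
      refine ⟨Classical.arbitrary V, fun u hu _ => ?_⟩
      have := h u hu
      rw [isFull_iff_card_missing hu] at this
      omega
  obtain ⟨t, ht⟩ := hex
  set A := Finset.univ.filter (c · = false) with hA
  set B := Finset.univ.filter (c · = true) with hB
  have memA : ∀ u, u ∈ A ↔ c u = false := by simp [hA]
  have hlow : (A.erase t).card ≤ ∑ v ∈ A.erase t, (missing G c v).card := by
    rw [Finset.card_eq_sum_ones]
    refine Finset.sum_le_sum fun u hu => ht u ?_ (Finset.ne_of_mem_erase hu)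
    exact (memA u).1 (Finset.mem_of_mem_erase hu)
  have hsub : ∑ v ∈ A.erase t, (missing G c v).card ≤ ∑ v ∈ A, (missing G c v).card :=
    Finset.sum_le_sum_of_subset (Finset.erase_subset _ _)
  have hpred : A.card - 1 ≤ (A.erase t).card := Finset.pred_card_le_card_erase
  obtain ⟨d, hd⟩ : ∃ d, A.card = B.card + d := ⟨A.card - B.card, by omega⟩
  obtain ⟨s, hs⟩ : ∃ s, ∑ v ∈ A, (missing G c v).card = A.card - 1 + s :=
    ⟨∑ v ∈ A, (missing G c v).card - (A.card - 1), by omega⟩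
  have hds : d ≤ 1 ∧ s = 0 := by
    rw [← hcard, hd] at he
    rw [hs, hd] at hsum
    have h1 : B.card + d - 1 + 1 = B.card + d := by omega
    have h2 : B.card + d + B.card - 1 + 1 = B.card + d + B.card := by omega
    generalize B.card + d - 1 = x at *
    generalize B.card + d + B.card - 1 = y at *
    generalize B.card = b at *
    zify at *
    have hx : (x : ℤ) = b + d - 1 := by linarith
    have hy : (y : ℤ) = b + d + b - 1 := by linarith
    rw [hx] at hsum
    rw [hy] at he
    -- with `e = (b+d)b - (b+d-1) - s` edges, this is `(2b+d-1)² ≤ 4e`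
    have key : (d : ℤ) * d + 2 * d + 4 * s ≤ 3 := by nlinarith
    constructor
    · by_contra! h; nlinarith
    · have : (0 : ℤ) ≤ d * d + 2 * d := by positivity
      omega
  obtain ⟨hd1, rfl⟩ := hds
  -- a vertex without missing edges exists, as the number of missing edges is less than `#A`
  have hexfull : ∃ u, c u = false ∧ IsFull G c u := by
    by_contra! h
    have : A.card ≤ ∑ v ∈ A, (missing G c v).card := by
      rw [Finset.card_eq_sum_ones]
      refine Finset.sum_le_sum fun u hu => ?_
      have h1 := h u ((memA u).1 hu)
      rw [isFull_iff_card_missing ((memA u).1 hu)] at h1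
      omega
    omega
  obtain ⟨f, hf, ff⟩ := hexfull
  -- the other `#A - 1` vertices of colour `false` share the `#A - 1` missing edges evenly
  have hmiss : ∀ u, c u = false → (missing G c u).card ≤ 1 := by
    intro u hu
    by_contra! h
    have : ∑ v ∈ A.erase f, 1 < ∑ v ∈ A.erase f, (missing G c v).card := by
      refine Finset.sum_lt_sum (fun v hv => ?_) ⟨u, ?_, h⟩
      · by_contra! h0
        have hvA := (memA v).1 (Finset.mem_of_mem_erase hv)
        exact Finset.ne_of_mem_erase hv
          (hfull _ _ hvA hf ((isFull_iff_card_missing hvA).2 (by omega)) ff)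
      · refine Finset.mem_erase.2 ⟨?_, (memA u).2 hu⟩
        rintro rfl
        rw [isFull_iff_card_missing hu] at ff
        omega
    rw [← Finset.card_eq_sum_ones, Finset.card_erase_of_mem ((memA f).2 hf)] at this
    have h2 : ∑ v ∈ A.erase f, (missing G c v).card ≤ ∑ v ∈ A, (missing G c v).card :=
      Finset.sum_le_sum_of_subset (Finset.erase_subset _ _)
    omega
  have hA1 : ∀ u v w, c u = false → c v = true → c w = true → ¬ G.Adj u v → ¬ G.Adj u w →
      v = w := by
    intro u v w hu hv hw huv huw
    exact Finset.card_le_one.1 (hmiss u hu) v (mem_missing.2 ⟨hv, huv⟩) w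
      (mem_missing.2 ⟨hw, huw⟩)
  have nadj : ∀ x y, c x = c y → ¬ G.Adj x y := fun x y hxy h => hc _ _ h hxy
  have full_adj : ∀ p y, c y = false → G.Adj p y → G.Adj p f := by
    intro p y hy hpy
    exact (ff p (by rw [hf, ← hy]; exact hc _ _ hpy)).symm
  refine ⟨hc, ?_, ?_, ⟨f, hf, ff⟩, ?_⟩
  · intro u v w hv hw huv huw
    rcases hu : c u with _ | _
    · rw [hu] at hv hw
      exact hA1 u v w hu (by simpa using hv) (by simpa using hw) huv huw
    · -- two vertices `v`, `w` missing the same vertex `u` would be twins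
      by_contra hne
      rw [hu] at hv hw
      have hv : c v = false := by simpa using hv
      have hw : c w = false := by simpa using hw
      have twin : ∀ v w p, c v = false → c w = false → ¬ G.Adj u w → G.Adj p v →
          ¬ G.Adj u v → G.Adj p w := by
        intro v w p hv hw huw hpv huv
        by_contra hpw
        have hp : c p = true := by
          have := hc _ _ hpv
          rw [hv] at this; simpa using this
        have := hA1 w p u hw hp hu (fun h => hpw h.symm) (fun h => huw h.symm)
        exact huv (this ▸ hpv)
      have hvf : v ≠ f := by
        rintro rfl
        exact huv (ff u (by rw [hu, hf]; simp)).symm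
      have hwf : w ≠ f := by
        rintro rfl
        exact huw (ff u (by rw [hu, hf]; simp)).symm
      rcases hG.incomparable hne hwf hvf (nadj _ _ (hv.trans hw.symm))
        (nadj _ _ (hw.trans hf.symm)) (nadj _ _ (hv.trans hf.symm)) with
        ⟨⟨p, hp, hp'⟩, -⟩ | ⟨⟨p, hp, hp'⟩, -⟩ | ⟨⟨p, hp, hp'⟩, -⟩
      · exact hp' (twin v w p hv hw huw hp huv)
      · exact hp' (full_adj _ _ hw hp)
      · exact hp' (full_adj _ _ hv hp)
  · intro u v huv fu fv
    rcases hu : c u with _ | _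
    · exact hfull u v hu (huv ▸ hu) fu fv
    · have hB3 : 3 ≤ B.card := by omega
      exact hG.eq_of_isFull hc hB3 hu (huv ▸ hu) fu fv
  · change A.card = B.card ∨ A.card = B.card + 1
    omega

lemma IsNearCompleteBipartite.ncard_edgeSet {V : Type*} [Fintype V] {G : SimpleGraph V}
    {c : V → Bool} (h : IsNearCompleteBipartite G c) :
    G.edgeSet.ncard + ((Finset.univ.filter (c · = false)).card - 1) =
      (Finset.univ.filter (c · = false)).card * (Finset.univ.filter (c · = true)).card := by
  classical
  rw [← ncard_edgeSet_add_sum_missing h.proper]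
  congr 1
  obtain ⟨f, hf, ff⟩ := h.exists_isFull
  rw [← Finset.card_erase_of_mem (a := f) (by simp [hf]), Finset.card_eq_sum_ones]
  refine Finset.sum_subset_zero_on_sdiff (Finset.erase_subset _ _) ?_ ?_
  · intro x hx
    simp only [Finset.mem_sdiff, Finset.mem_filter, Finset.mem_univ, true_and,
      Finset.mem_erase, not_and, ne_eq] at hx
    have : x = f := by
      by_contra hne
      exact hx.2 hne hx.1
    subst this
    exact (isFull_iff_card_missing hf).1 ff
  · intro x hx
    simp only [Finset.mem_filter, Finset.mem_univ, true_and, Finset.mem_erase] at hx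
    have h1 : (missing G c x).card ≠ 0 := fun h0 =>
      hx.1 (h.eq_of_isFull _ _ (hx.2.trans hf.symm) ((isFull_iff_card_missing hx.2).2 h0) ff)
    have h2 : (missing G c x).card ≤ 1 := by
      rw [Finset.card_le_one]
      intro a ha b hb
      rw [mem_missing] at ha hb
      exact h.eq_of_not_adj x a b (by simp [ha.1, hx.2]) (by simp [hb.1, hx.2]) ha.2 hb.2
    omega

/-- A near-complete bipartite graph with `2r` or `2r + 1` vertices has `r(r-1)+1` or `r²` edges,
respectively; either way this is `⌈(n-1)²/4⌉`. -/
lemma IsNearCompleteBipartite.ncard_edgeSet_eq {V : Type*} [Fintype V] {G : SimpleGraph V}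
    {c : V → Bool} (h : IsNearCompleteBipartite G c) :
    G.edgeSet.ncard = ⌈((Fintype.card V : ℚ) - 1) ^ 2 / 4⌉₊ := by
  have h1 := h.ncard_edgeSet
  have h2 := card_false_add_card_true c
  have h3 := h.card
  have h4 : 0 < (Finset.univ.filter (c · = false)).card := by
    obtain ⟨f, hf, -⟩ := h.exists_isFull
    exact Finset.card_pos.2 ⟨f, by simp [hf]⟩
  generalize (Finset.univ.filter (c · = false)).card = a at *
  generalize (Finset.univ.filter (c · = true)).card = b at *
  obtain ⟨k, rfl⟩ : ∃ k, a = k + 1 := ⟨a - 1, by omega⟩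
  symm
  rw [← h2]
  have h5 : (G.edgeSet.ncard : ℚ) + k = (k + 1) * b := by
    have : G.edgeSet.ncard + k = (k + 1) * b := by simpa using h1
    exact_mod_cast this
  rcases Nat.eq_zero_or_pos G.edgeSet.ncard with h0 | h0
  · rcases h3 with h3 | h3
    · subst h3
      rw [h0] at h5
      push_cast at h5
      nlinarith
    · have : k = b := by omega
      subst this
      rw [h0] at h5 ⊢
      have hk : (k : ℚ) = 0 := by
        have : (k : ℚ) * k = 0 := by push_cast at h5; linarith
        simpa using this
      push_cast
      rw [hk]; norm_num
  · rw [Nat.ceil_eq_iff (by omega), Nat.cast_pred h0]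
    have h6 : (G.edgeSet.ncard : ℚ) = (k + 1) * b - k := by linarith
    rw [h6]
    rcases h3 with h3 | h3
    · subst h3
      push_cast
      constructor <;> nlinarith
    · have : k = b := by omega
      subst this
      push_cast
      constructor <;> nlinarith

/-- In a near-complete bipartite graph, three vertices of one colour lie on an induced path on five
vertices, and other triples on one with at most four. -/
theorem IsNearCompleteBipartite.triplesOnMonophonic {V : Type*} [Fintype V] {G : SimpleGraph V}
    {c : V → Bool} (h : IsNearCompleteBipartite G c) (hn : 6 ≤ Fintype.card V) :
    TriplesOnMonophonic G := by
  classical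
  have hcard := card_false_add_card_true c
  have hsize : ∀ b, 3 ≤ (Finset.univ.filter (c · = b)).card := by
    have := h.card
    intro b
    cases b <;> omega
  have nadj : ∀ x y, c x = c y → ¬ G.Adj x y := fun x y hxy h' => h.proper _ _ h' hxy
  have hcc : ∀ x y z, c x ≠ c z → c y ≠ c z → c x = c y := by
    intro x y z; cases c x <;> cases c y <;> cases c z <;> simp
  have partner : ∀ x, ¬ IsFull G c x → ∃ y, c y ≠ c x ∧ ¬ G.Adj x y := by
    intro x hx
    simpa [IsFull] using hx
  -- two vertices of one colour together with one of the other colour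
  have two_one : ∀ x y b, x ≠ y → c x = c y → c b ≠ c x → ∃ (u v : V) (p : G.Walk u v),
      IsMonophonic p ∧ x ∈ p.support ∧ y ∈ p.support ∧ b ∈ p.support := by
    intro x y b hxy cxy cb
    have main : ∀ x y, x ≠ y → c x = c y → c b ≠ c x → ¬ G.Adj x b → ∃ (u v : V) (p : G.Walk u v),
        IsMonophonic p ∧ x ∈ p.support ∧ y ∈ p.support ∧ b ∈ p.support := by
      intro x y hxy cxy cb nxb
      have ayb : G.Adj y b := by
        by_contra nyb
        exact hxy (h.eq_of_not_adj b x y (Ne.symm cb) (by rw [← cxy]; exact Ne.symm cb)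
          (fun e => nxb e.symm) (fun e => nyb e.symm))
      obtain ⟨d, hd⟩ : ∃ d, c d = c b ∧ d ≠ b ∧ G.Adj y d := by
        by_contra! hno
        have : (Finset.univ.filter (c · = c b)).card ≤ 2 := by
          refine le_trans ?_ (Finset.card_le_two (a := b)
            (b := if hy : IsFull G c y then b else (partner y hy).choose))
          refine Finset.card_le_card fun d hd => ?_
          simp only [Finset.mem_filter, Finset.mem_univ, true_and] at hd
          by_cases hdb : d = b
          · simp [hdb]
          · have hyd := hno d hd hdb
            have hcd : c d ≠ c y := by rw [hd, ← cxy]; exact cb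
            have hy : ¬ IsFull G c y := fun hf => hyd (hf d hcd)
            have hs := (partner y hy).choose_spec
            have := h.eq_of_not_adj y d _ hcd hs.1 hyd hs.2
            simp only [hy, dite_false, Finset.mem_insert, Finset.mem_singleton]
            exact Or.inr this
        have := hsize (c b)
        omega
      have axd : G.Adj x d := by
        by_contra nxd
        exact hd.2.1 (h.eq_of_not_adj x d b (by rw [hd.1]; exact cb) cb nxd nxb)
      obtain ⟨u, v, p, hp, hs⟩ := exists_isMonophonic_four (G := G) (a := x) (b := d) (c := y)
        (d := b) hxy hd.2.1 (fun e => cb (e ▸ rfl)) axd hd.2.2.symm ayb (nadj _ _ cxy)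
        (nadj _ _ hd.1) nxb
      exact ⟨u, v, p, hp, by simp [hs], by simp [hs], by simp [hs]⟩
    by_cases hxb : G.Adj x b
    · by_cases hyb : G.Adj y b
      · obtain ⟨u, v, p, hp, hs⟩ := exists_isMonophonic_three hxy hxb hyb.symm (nadj _ _ cxy)
        exact ⟨u, v, p, hp, by simp [hs], by simp [hs], by simp [hs]⟩
      · obtain ⟨u, v, p, hp, h1, h2, h3⟩ := main y x hxy.symm cxy.symm (by rw [← cxy]; exact cb) hyb
        exact ⟨u, v, p, hp, h2, h1, h3⟩
    · exact main x y hxy cxy cb hxb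
  have three : ∀ x y z, x ≠ y → y ≠ z → x ≠ z → c x = c y → c y = c z → ¬ IsFull G c x →
      ¬ IsFull G c z → ∃ (u v : V) (p : G.Walk u v),
      IsMonophonic p ∧ x ∈ p.support ∧ y ∈ p.support ∧ z ∈ p.support := by
    intro x y z hxy hyz hxz cxy cyz fx fz
    obtain ⟨x', cx', nx'⟩ := partner x fx
    obtain ⟨z', cz', nz'⟩ := partner z fz
    have cxz := cxy.trans cyz
    have key : ∀ u v u', c u = c v → u ≠ v → c u' ≠ c u → ¬ G.Adj u u' → G.Adj v u' := by
      intro u v u' cuv huv cu' nu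
      by_contra nv
      exact huv (h.eq_of_not_adj u' u v (Ne.symm cu') (by rw [← cuv]; exact Ne.symm cu')
        (fun e => nu e.symm) (fun e => nv e.symm))
    have hx'z' : x' ≠ z' := by
      rintro rfl
      exact nz' (key x z x' cxz hxz cx' nx')
    obtain ⟨u, v, p, hp, hs⟩ := exists_isMonophonic_five (G := G) (a := x) (b := z') (c := y)
      (d := x') (e := z) hxy (Ne.symm hx'z') (fun e => cx' (e ▸ rfl)) hxz
      (fun e => cz' (e ▸ rfl)) hyz
      (key z x z' cxz.symm hxz.symm cz' nz') (key z y z' cyz.symm hyz.symm cz' nz').symm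
      (key x y x' cxy hxy cx' nx') (key x z x' cxz hxz cx' nx').symm
      (nadj _ _ cxy) (nadj _ _ (hcc _ _ x (by rw [cxz]; exact cz') cx')) nx' (nadj _ _ cxz)
      (fun e => nz' e.symm) (nadj _ _ cyz)
    exact ⟨u, v, p, hp, by simp [hs], by simp [hs], by simp [hs]⟩
  intro x y z hxy hyz hxz
  by_cases cxy : c x = c y
  · by_cases cyz : c y = c z
    · by_cases fx : IsFull G c x
      · have fy : ¬ IsFull G c y := fun f => hxy (h.eq_of_isFull _ _ cxy fx f)
        have fz : ¬ IsFull G c z := fun f => hxz (h.eq_of_isFull _ _ (cxy.trans cyz) fx f)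
        obtain ⟨u, v, p, hp, h1, h2, h3⟩ :=
          three y x z hxy.symm hxz hyz cxy.symm (cxy.trans cyz) fy fz
        exact ⟨u, v, p, hp, h2, h1, h3⟩
      · by_cases fz : IsFull G c z
        · have fy : ¬ IsFull G c y := fun f => hyz (h.eq_of_isFull _ _ cyz f fz)
          obtain ⟨u, v, p, hp, h1, h2, h3⟩ :=
            three x z y hxz hyz.symm hxy (cxy.trans cyz) cyz.symm fx fy
          exact ⟨u, v, p, hp, h1, h3, h2⟩
        · exact three x y z hxy hyz hxz cxy cyz fx fz
    · exact two_one x y z hxy cxy (by rw [cxy]; exact Ne.symm cyz)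
  · by_cases cyz : c y = c z
    · obtain ⟨u, v, p, hp, h1, h2, h3⟩ := two_one y z x hyz cyz cxy
      exact ⟨u, v, p, hp, h3, h1, h2⟩
    · obtain ⟨u, v, p, hp, h1, h2, h3⟩ :=
        two_one x z y hxz (hcc x z y cxy (Ne.symm cyz)) (Ne.symm cxy)
      exact ⟨u, v, p, hp, h1, h3, h2⟩

/-! ### Uniqueness of the near-complete bipartite graph -/

/-- The infinite near-complete bipartite graph on two copies of `ℕ`, in which `(false, i)` and
`(true, i)` are non-adjacent for `i ≠ 0`, and all other pairs of different colour are adjacent. -/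
def nearModel : SimpleGraph (Bool × ℕ) where
  Adj x y := x.1 ≠ y.1 ∧ (x.2 ≠ y.2 ∨ x.2 = 0)
  symm := ⟨fun x y h => ⟨h.1.symm, by have := h.2; omega⟩⟩
  loopless := ⟨fun _ h => h.1 rfl⟩

/-- A near-complete bipartite graph is the subgraph of `nearModel` induced on the vertices of index
less than `a`, without `(true, 0)` if there is no full vertex of colour `true`. -/
lemma IsNearCompleteBipartite.exists_embedding {V : Type*} [Fintype V] {G : SimpleGraph V}
    {c : V → Bool} (h : IsNearCompleteBipartite G c) :
    ∃ e : G ↪g nearModel, Set.range e = {x | x.2 < (Finset.univ.filter (c · = false)).card ∧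
      (x = (true, 0) → (Finset.univ.filter (c · = false)).card =
        (Finset.univ.filter (c · = true)).card)} := by
  classical
  obtain ⟨f, hf, ff⟩ := h.exists_isFull
  have partner : ∀ x, ∃ y, ¬ IsFull G c x → c y ≠ c x ∧ ¬ G.Adj x y := by
    intro x
    by_cases hx : IsFull G c x
    · exact ⟨x, fun h => absurd hx h⟩
    · have : ∃ y, c y ≠ c x ∧ ¬ G.Adj x y := by simpa [IsFull] using hx
      obtain ⟨y, hy⟩ := this
      exact ⟨y, fun _ => hy⟩
  choose p hp using partner
  have hpc : ∀ x, ¬ IsFull G c x → c (p x) ≠ c x := fun x hx => (hp x hx).1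
  have hpa : ∀ x, ¬ IsFull G c x → ¬ G.Adj x (p x) := fun x hx => (hp x hx).2
  have hpf : ∀ x, ¬ IsFull G c x → ¬ IsFull G c (p x) := fun x hx hfull =>
    hpa x hx (hfull x (Ne.symm (hpc x hx))).symm
  have hpp : ∀ x, ¬ IsFull G c x → p (p x) = x := fun x hx =>
    h.eq_of_not_adj (p x) _ _ (hpc _ (hpf x hx)) (Ne.symm (hpc x hx)) (hpa _ (hpf x hx))
      (fun e => hpa x hx e.symm)
  set T := Finset.univ.filter (fun v => c v = true ∧ ¬ IsFull G c v) with hT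
  have memT : ∀ v, v ∈ T ↔ c v = true ∧ ¬ IsFull G c v := by simp [hT]
  have hTcard : T.card + 1 = (Finset.univ.filter (c · = false)).card := by
    rw [← Finset.card_erase_add_one (a := f) (s := Finset.univ.filter (c · = false)) (by simp [hf])]
    congr 1
    have nf : ∀ v ∈ (Finset.univ.filter (c · = false)).erase f, c v = false ∧ ¬ IsFull G c v := by
      intro v hv
      simp only [Finset.mem_erase, Finset.mem_filter, Finset.mem_univ, true_and] at hv
      exact ⟨hv.2, fun fv => hv.1 (h.eq_of_isFull _ _ (hv.2.trans hf.symm) fv ff)⟩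
    symm
    refine Finset.card_bij (fun v _ => p v) ?_ ?_ ?_
    · intro v hv
      obtain ⟨h1, h2⟩ := nf v hv
      have := hpc v h2
      rw [h1] at this
      exact (memT _).2 ⟨by simpa using this, hpf v h2⟩
    · intro v hv w hw hvw
      have := congrArg p hvw
      rwa [hpp _ (nf v hv).2, hpp _ (nf w hw).2] at this
    · intro v hv
      obtain ⟨h1, h2⟩ := (memT v).1 hv
      refine ⟨p v, ?_, hpp v h2⟩
      have hcp := hpc v h2
      rw [h1] at hcp
      simp only [Finset.mem_erase, Finset.mem_filter, Finset.mem_univ, true_and]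
      refine ⟨?_, by simpa using hcp⟩
      intro hpvf
      exact hpf v h2 (hpvf ▸ ff)
  obtain ⟨g, hgpos, hginj, hglt, hgsurj⟩ : ∃ g : V → ℕ, (∀ v ∈ T, g v ≠ 0) ∧
      (∀ v ∈ T, ∀ w ∈ T, g v = g w → v = w) ∧ (∀ v ∈ T, g v < T.card + 1) ∧
      ∀ i, i ≠ 0 → i < T.card + 1 → ∃ v ∈ T, g v = i := by
    refine ⟨fun v => if hv : v ∈ T then (T.equivFin ⟨v, hv⟩ : ℕ) + 1 else 0, ?_, ?_, ?_, ?_⟩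
    · intro v hv; simp [hv]
    · intro v hv w hw hvw
      simp only [hv, hw, dite_true, Nat.add_right_cancel_iff] at hvw
      simpa using T.equivFin.injective (Fin.ext hvw)
    · intro v hv; simp [hv]
    · intro i hi hi'
      refine ⟨T.equivFin.symm ⟨i - 1, by omega⟩, Subtype.coe_prop _, ?_⟩
      simp
      omega
  -- `rep` sends matched vertices to their representative of colour `true`
  let rep : V → V := fun v => if c v = true then v else p v
  have hrep : ∀ v, ¬ IsFull G c v → rep v ∈ T := by
    intro v hv
    rw [memT]
    by_cases hc : c v = true
    · simp only [rep, hc, if_true]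
      exact ⟨trivial, hv⟩
    · simp only [rep, hc]
      have := hpc v hv
      refine ⟨?_, hpf v hv⟩
      simp only [Bool.not_eq_true] at hc
      rw [hc] at this
      simpa using this
  let idx : V → ℕ := fun v => if IsFull G c v then 0 else g (rep v)
  have idx0 : ∀ v, IsFull G c v → idx v = 0 := fun v hv => by simp [idx, hv]
  have idx1 : ∀ v, ¬ IsFull G c v → idx v = g (rep v) := fun v hv => by simp [idx, hv]
  have idxpos : ∀ v, ¬ IsFull G c v → idx v ≠ 0 := fun v hv => by
    rw [idx1 v hv]; exact hgpos _ (hrep v hv)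
  have idx_eq : ∀ u v, ¬ IsFull G c u → ¬ IsFull G c v → (idx u = idx v ↔ rep u = rep v) := by
    intro u v hu hv
    rw [idx1 u hu, idx1 v hv]
    exact ⟨hginj _ (hrep u hu) _ (hrep v hv), fun h => by rw [h]⟩
  have hinj : Function.Injective (fun v => (c v, idx v)) := by
    intro u v huv
    simp only [Prod.mk.injEq] at huv
    obtain ⟨h1, h2⟩ := huv
    by_cases fu : IsFull G c u
    · by_cases fv : IsFull G c v
      · exact h.eq_of_isFull u v h1 fu fv
      · rw [idx0 u fu] at h2
        exact absurd h2.symm (idxpos v fv)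
    · by_cases fv : IsFull G c v
      · rw [idx0 v fv] at h2
        exact absurd h2 (idxpos u fu)
      · rw [idx_eq u v fu fv] at h2
        by_cases hc : c u = true
        · simpa [rep, hc, ← h1] using h2
        · have h3 : p u = p v := by simpa [rep, hc, ← h1] using h2
          rw [← hpp u fu, h3, hpp v fv]
  have hadj1 : ∀ u v, c u = false → c v = true → ¬ IsFull G c u → ¬ IsFull G c v →
      (G.Adj u v ↔ idx u ≠ idx v) := by
    intro u v hu hv fu fv
    rw [Ne, idx_eq u v fu fv]
    have : rep u = p u := by simp [rep, hu]
    rw [this]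
    have : rep v = v := by simp [rep, hv]
    rw [this]
    constructor
    · rintro h1 rfl
      exact hpa u fu h1
    · intro h1
      by_contra h2
      exact h1 (h.eq_of_not_adj u _ _ (hpc u fu) (by simp [hu, hv]) (hpa u fu) h2)
  refine ⟨⟨⟨_, hinj⟩, ?_⟩, ?_⟩
  · intro u v
    change (c u ≠ c v ∧ (idx u ≠ idx v ∨ idx u = 0)) ↔ G.Adj u v
    by_cases hc : c u = c v
    · simp only [hc, ne_eq, not_true_eq_false, false_and, false_iff]
      exact fun h' => h.proper _ _ h' hc
    · by_cases fu : IsFull G c u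
      · simp only [idx0 u fu, or_true, and_true, ne_eq, hc, not_false_eq_true, true_iff]
        exact fu v (Ne.symm hc)
      · by_cases fv : IsFull G c v
        · simp only [idx0 v fv, ne_eq, hc, not_false_eq_true, true_and, idxpos u fu, true_or,
            true_iff]
          exact (fv u hc).symm
        · simp only [ne_eq, hc, not_false_eq_true, true_and, idxpos u fu, or_false]
          rcases hu : c u with _ | _
          · exact (hadj1 u v hu (by rw [hu] at hc; simpa using Ne.symm hc) fu fv).symm
          · rw [G.adj_comm, hadj1 v u (by rw [hu] at hc; simpa using Ne.symm hc) hu fv fu]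
            exact ⟨fun h => Ne.symm h, fun h => Ne.symm h⟩
  · rw [← hTcard]
    ext ⟨b, i⟩
    simp only [Set.mem_range, Set.mem_ofPred_eq, RelEmbedding.coe_mk, Function.Embedding.coeFn_mk,
      Prod.mk.injEq]
    have hTsub : T ⊆ Finset.univ.filter (c · = true) := by
      intro v hv
      simpa using ((memT v).1 hv).1
    constructor
    · rintro ⟨v, rfl, rfl⟩
      by_cases fv : IsFull G c v
      · rw [idx0 v fv]
        refine ⟨by omega, ?_⟩
        rintro ⟨hv, -⟩
        have : T.card < (Finset.univ.filter (c · = true)).card := by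
          refine Finset.card_lt_card (Finset.ssubset_iff_subset_ne.2 ⟨hTsub, fun hEq => ?_⟩)
          have : v ∈ T := hEq ▸ (by simp [hv])
          exact ((memT v).1 this).2 fv
        have := h.card
        omega
      · refine ⟨?_, fun h => absurd h.2 (idxpos v fv)⟩
        rw [idx1 v fv]
        exact hglt _ (hrep v fv)
    · rintro ⟨hi, hcond⟩
      by_cases hi0 : i = 0
      · subst hi0
        cases b with
        | false => exact ⟨f, hf, idx0 f ff⟩
        | true =>
          have hc := hcond ⟨rfl, rfl⟩
          obtain ⟨v, hv, hv'⟩ := Finset.exists_mem_notMem_of_card_lt_card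
            (s := T) (t := Finset.univ.filter (c · = true)) (by omega)
          simp only [Finset.mem_filter, Finset.mem_univ, true_and] at hv
          rw [memT] at hv'
          have fv : IsFull G c v := by
            by_contra fv
            exact hv' ⟨hv, fv⟩
          exact ⟨v, hv, idx0 v fv⟩
      · obtain ⟨v, hv, rfl⟩ := hgsurj i hi0 hi
        obtain ⟨hc, fv⟩ := (memT v).1 hv
        cases b with
        | true =>
          refine ⟨v, hc, ?_⟩
          rw [idx1 v fv]
          simp [rep, hc]
        | false =>
          have hcp : c (p v) = false := by
            have := hpc v fv
            rw [hc] at this; simpa using this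
          refine ⟨p v, hcp, ?_⟩
          rw [idx1 _ (hpf v fv)]
          simp [rep, hcp, hpp v fv]

theorem IsNearCompleteBipartite.nonempty_iso {V W : Type*} [Fintype V] [Fintype W]
    {G : SimpleGraph V} {H : SimpleGraph W} {c : V → Bool} {d : W → Bool}
    (hG : IsNearCompleteBipartite G c) (hH : IsNearCompleteBipartite H d)
    (hcard : Fintype.card V = Fintype.card W) : Nonempty (G ≃g H) := by
  obtain ⟨e, he⟩ := hG.exists_embedding
  obtain ⟨e', he'⟩ := hH.exists_embedding
  have h1 := card_false_add_card_true c
  have h2 := card_false_add_card_true d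
  have h3 := hG.card
  have h4 := hH.card
  have hA : (Finset.univ.filter (c · = false)).card = (Finset.univ.filter (d · = false)).card := by
    omega
  have hB : (Finset.univ.filter (c · = true)).card = (Finset.univ.filter (d · = true)).card := by
    omega
  have hr : Set.range e = Set.range e' := by rw [he, he', hA, hB]
  let φ : V ≃ W := (Equiv.ofInjective e e.injective).trans
    ((Equiv.setCongr hr).trans (Equiv.ofInjective e' e'.injective).symm)
  have hφ : ∀ v, e' (φ v) = e v := by
    intro v
    have : Equiv.ofInjective e' e'.injective (φ v) =
        Equiv.setCongr hr (Equiv.ofInjective e e.injective v) := by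
      simp [φ]
    simpa using congrArg Subtype.val this
  refine ⟨⟨φ, ?_⟩⟩
  intro u v
  rw [← e'.map_adj_iff, hφ, hφ, e.map_adj_iff]

lemma IsNearCompleteBipartite.of_iso {V W : Type*} [Fintype V] [Fintype W]
    {G : SimpleGraph V} {H : SimpleGraph W} {d : W → Bool}
    (hH : IsNearCompleteBipartite H d) (φ : G ≃g H) :
    IsNearCompleteBipartite G (fun v => d (φ v)) := by
  have hfull : ∀ u, IsFull G (fun v => d (φ v)) u → IsFull H d (φ u) := by
    intro u hu w hw
    have := hu (φ.symm w) (by simpa using hw)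
    simpa using φ.map_adj_iff.2 this
  have hcard : ∀ b, (Finset.univ.filter (fun v => d (φ v) = b)).card =
      (Finset.univ.filter (d · = b)).card := by
    intro b
    refine Finset.card_bij (fun v _ => φ v) ?_ ?_ ?_
    · intro v hv; simpa using hv
    · intro v _ w _ hvw; exact φ.injective hvw
    · intro w hw
      exact ⟨φ.symm w, by simpa using hw, by simp⟩
  refine ⟨fun u v huv => hH.proper _ _ (φ.map_adj_iff.2 huv), ?_, ?_, ?_, ?_⟩
  · intro u v w hv hw huv huw
    exact φ.injective (hH.eq_of_not_adj (φ u) (φ v) (φ w) hv hw (by rwa [φ.map_adj_iff])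
      (by rwa [φ.map_adj_iff]))
  · intro u v huv fu fv
    exact φ.injective (hH.eq_of_isFull _ _ huv (hfull u fu) (hfull v fv))
  · obtain ⟨f, hf, ff⟩ := hH.exists_isFull
    refine ⟨φ.symm f, by simpa using hf, ?_⟩
    intro w hw
    have := ff (φ w) (by simpa using hw)
    rw [← φ.map_adj_iff]
    simpa using this
  · rw [hcard, hcard]
    exact hH.card

/-! ### The graphs `T*_{n,2}` and `T*_{n,2}` plus a cross edge -/

lemma card_range_filter_odd (n : ℕ) :
    ((Finset.range n).filter (fun i => i % 2 = 1)).card = n / 2 := by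
  induction n with
  | zero => simp
  | succ k ih =>
    rw [Finset.range_add_one, Finset.filter_insert]
    split_ifs with h
    · rw [Finset.card_insert_of_notMem (by simp), ih]; omega
    · rw [ih]; omega

lemma card_filter_mod_two (n : ℕ) :
    (Finset.univ.filter fun v : Fin n => decide (v.val % 2 = 1) = true).card = n / 2 := by
  rw [← card_range_filter_odd]
  refine Finset.card_bij (fun v _ => v.val) ?_ ?_ ?_
  · intro v hv
    simp only [decide_eq_true_eq, Finset.mem_filter, Finset.mem_univ, true_and] at hv
    simp [hv]
  · intro v _ w _ h; exact Fin.ext h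
  · intro i hi
    simp only [Finset.mem_filter, Finset.mem_range] at hi
    exact ⟨⟨i, hi.1⟩, by simp [hi.2], rfl⟩

/-- The complete bipartite graph between the even and the odd numbers below `n`, minus the edges
`{2i, 2i+1}` with `i ≠ j`, is near-complete bipartite. For odd `n`, the even number `n - 1` has no
partner, and `j` has to be its index. -/
lemma isNearCompleteBipartite_of_adj_iff {n j : ℕ} {G : SimpleGraph (Fin n)} (hj : 2 * j < n)
    (hodd : n % 2 = 1 → j = n / 2)
    (hG : ∀ x y, G.Adj x y ↔ x.val % 2 ≠ y.val % 2 ∧ (x.val / 2 ≠ y.val / 2 ∨ x.val / 2 = j)) :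
    IsNearCompleteBipartite G (fun v => decide (v.val % 2 = 1)) := by
  have hc : ∀ u v : Fin n, decide (u.val % 2 = 1) ≠ decide (v.val % 2 = 1) ↔
      u.val % 2 ≠ v.val % 2 := by
    intro u v
    rw [Ne, decide_eq_decide]
    omega
  have hfull : ∀ u, IsFull G (fun v => decide (v.val % 2 = 1)) u ↔ u.val / 2 = j := by
    intro u
    constructor
    · intro hu
      by_contra hne
      have hlt : 2 * (u.val / 2) + (1 - u.val % 2) < n := by
        have := u.isLt
        omega
      have := hu ⟨2 * (u.val / 2) + (1 - u.val % 2), hlt⟩ (by rw [hc]; simp only []; omega)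
      rw [hG] at this
      simp only [] at this
      omega
    · intro hu w hw
      rw [hc] at hw
      rw [hG]
      exact ⟨Ne.symm hw, Or.inr hu⟩
  refine ⟨?_, ?_, ?_, ?_, ?_⟩
  · intro u v huv
    rw [hc]
    exact ((hG u v).1 huv).1
  · intro u v w hv hw huv huw
    rw [hc] at hv hw
    rw [hG] at huv huw
    apply Fin.ext
    omega
  · intro u v huv fu fv
    rw [hfull] at fu fv
    rw [decide_eq_decide] at huv
    apply Fin.ext
    omega
  · refine ⟨⟨2 * j, hj⟩, by simp, ?_⟩
    rw [hfull]
    simp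
  · have h1 := card_filter_mod_two n
    have h2 := card_false_add_card_true (fun v : Fin n => decide (v.val % 2 = 1))
    rw [Fintype.card_fin] at h2
    omega

lemma tStar_two_adj {n : ℕ} {v w : Fin n} : (tStar n 2).Adj v w ↔
    v.val % 2 ≠ w.val % 2 ∧ ¬ (v.val / 2 = w.val / 2 ∧ v.val / 2 < n / 2) := Iff.rfl

lemma isNearCompleteBipartite_tStar {n : ℕ} (hn : Odd n) :
    IsNearCompleteBipartite (tStar n 2) (fun v => decide (v.val % 2 = 1)) := by
  have hn' := Nat.odd_iff.1 hn
  refine isNearCompleteBipartite_of_adj_iff (j := n / 2) (by omega) (fun _ => rfl) ?_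
  intro x y
  rw [tStar_two_adj]
  have := x.isLt
  have := y.isLt
  omega

lemma isNewCrossEdge_two_iff {n : ℕ} {v w : Fin n} : IsNewCrossEdge n 2 v w ↔
    v.val % 2 ≠ w.val % 2 ∧ v.val / 2 = w.val / 2 ∧ v.val / 2 < n / 2 := by
  rw [IsNewCrossEdge, tStar_two_adj, turanGraph_adj]
  tauto

lemma isNearCompleteBipartite_tStar_sup_edge {n : ℕ} (hn : Even n) {v w : Fin n}
    (hvw : IsNewCrossEdge n 2 v w) :
    IsNearCompleteBipartite (tStar n 2 ⊔ edge v w) (fun v => decide (v.val % 2 = 1)) := by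
  rw [isNewCrossEdge_two_iff] at hvw
  have hn' := Nat.even_iff.1 hn
  refine isNearCompleteBipartite_of_adj_iff (j := v.val / 2) (by omega) (by omega) ?_
  intro x y
  rw [sup_adj, tStar_two_adj, edge_adj]
  simp only [Fin.ext_iff, ne_eq]
  have := x.isLt
  have := y.isLt
  omega

/-! ### Mantel's theorem and edge counting around a vertex family -/

lemma cliqueFree_three_of_triangleFree {V : Type*} {G : SimpleGraph V}
    (hG : ∀ x y z, G.Adj x y → G.Adj y z → ¬ G.Adj x z) : G.CliqueFree (2 + 1) := by
  classical
  intro s hs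
  obtain ⟨a, b, c, hab, hac, hbc, -⟩ := is3Clique_iff.1 hs
  exact hG a b c hab hbc hac

lemma two_mul_ncard_edgeSet {V : Type*} [Fintype V] (G : SimpleGraph V) [DecidableRel G.Adj] :
    2 * G.edgeSet.ncard = ∑ x, ∑ y, if G.Adj x y then 1 else 0 := by
  classical
  rw [← coe_edgeFinset, Set.ncard_coe_finset, ← sum_degrees_eq_twice_card_edges]
  refine Finset.sum_congr rfl fun x _ => ?_
  rw [← card_neighborFinset_eq_degree, neighborFinset_eq_filter, Finset.card_filter]

lemma four_mul_ncard_edgeSet_le {V : Type*} [Fintype V] {G : SimpleGraph V}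
    (hG : G.CliqueFree (2 + 1)) : 4 * G.edgeSet.ncard ≤ Fintype.card V ^ 2 := by
  classical
  rw [← coe_edgeFinset, Set.ncard_coe_finset]
  have h1 := hG.card_edgeFinset_le
  have h2 := mul_card_edgeFinset_turanGraph_le (n := Fintype.card V) (r := 2)
  rw [card_edgeFinset_turanGraph] at h2
  dsimp only at h1
  omega

/-- The equality case of Mantel's theorem. -/
lemma nonempty_iso_turanGraph_of_four_mul {V : Type*} [Fintype V] {G : SimpleGraph V}
    (hG : G.CliqueFree (2 + 1)) (he : Fintype.card V ^ 2 ≤ 4 * G.edgeSet.ncard) :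
    Nonempty (G ≃g turanGraph (Fintype.card V) 2) := by
  classical
  rw [← isTuranMaximal_iff_nonempty_iso_turanGraph (by omega)]
  refine ⟨hG, ?_⟩
  intro H _ hH
  have h1 := four_mul_ncard_edgeSet_le hH
  have h2 : G.edgeSet.ncard = G.edgeFinset.card := by
    rw [← coe_edgeFinset, Set.ncard_coe_finset]
  have h3 : H.edgeSet.ncard = H.edgeFinset.card := by
    rw [← coe_edgeFinset, Set.ncard_coe_finset]
  omega

open Classical in
/-- The number of indices `i` with `f i` adjacent to `x`. -/
noncomputable def degInto {V ι : Type*} [Fintype ι] (G : SimpleGraph V) (f : ι → V) (x : V) : ℕ :=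
  (Finset.univ.filter fun i => G.Adj x (f i)).card

/-- The subgraph of `G` induced on the vertices that are not values of `f`. -/
abbrev outside {V ι : Type*} (G : SimpleGraph V) (f : ι → V) : SimpleGraph ↥(Set.range f)ᶜ :=
  G.induce (Set.range f)ᶜ

lemma sum_eq_sum_add_sum_compl_range {V ι : Type*} [Fintype V] [Fintype ι] {f : ι → V}
    (hf : Function.Injective f) [Fintype ↥(Set.range f)ᶜ] (g : V → ℕ) :
    ∑ x, g x = ∑ i, g (f i) + ∑ w : ↥(Set.range f)ᶜ, g w := by
  classical
  rw [← (Equiv.Set.sumCompl (Set.range f)).sum_comp, Fintype.sum_sum_type]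
  congr 1
  rw [← (Equiv.ofInjective f hf).sum_comp]
  simp

/-- Twice the number of edges, sorted by how many ends lie in the range of `f`. -/
lemma two_mul_ncard_edgeSet_eq {V ι : Type*} [Fintype V] [Fintype ι] {f : ι → V}
    (hf : Function.Injective f) [Fintype ↥(Set.range f)ᶜ] (G : SimpleGraph V) :
    2 * G.edgeSet.ncard = ∑ i, degInto G f (f i) +
      2 * ∑ w : ↥(Set.range f)ᶜ, degInto G f w + 2 * (outside G f).edgeSet.ncard := by
  classical
  have hd : ∀ x, degInto G f x = ∑ i, if G.Adj x (f i) then 1 else 0 := by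
    intro x
    simp only [degInto, Finset.card_filter]
  rw [two_mul_ncard_edgeSet, two_mul_ncard_edgeSet, sum_eq_sum_add_sum_compl_range hf]
  simp only [sum_eq_sum_add_sum_compl_range hf (fun y => if G.Adj _ y then 1 else 0), hd,
    Finset.sum_add_distrib]
  rw [Finset.sum_comm (s := (Finset.univ : Finset ι))
    (t := (Finset.univ : Finset ↥(Set.range f)ᶜ))]
  simp only [G.adj_comm (f _) (Subtype.val _), comap_adj, Function.Embedding.subtype_apply]
  ring

/-! ### A shortest odd closed walk -/

lemma exists_walk_getVert {V : Type*} {G : SimpleGraph V} {u v : V} (p : G.Walk u v) {i j : ℕ}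
    (hij : i ≤ j) (hj : j ≤ p.length) :
    ∃ q : G.Walk (p.getVert i) (p.getVert j), q.length = j - i := by
  induction j, hij using Nat.le_induction with
  | base => exact ⟨.nil, by simp⟩
  | succ j hij ih =>
    obtain ⟨q, hq⟩ := ih (by omega)
    exact ⟨q.concat (p.adj_getVert_succ (by omega)), by rw [Walk.length_concat]; omega⟩

/-- `p` is an odd closed walk of minimum length among all odd closed walks of `G`. -/
structure IsShortestOdd {V : Type*} {G : SimpleGraph V} {u : V} (p : G.Walk u u) : Prop where
  odd : Odd p.length
  le : ∀ (w : V) (q : G.Walk w w), Odd q.length → p.length ≤ q.length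

lemma exists_isShortestOdd {V : Type*} {G : SimpleGraph V} (h : ¬ G.Colorable 2) :
    ∃ (u : V) (p : G.Walk u u), IsShortestOdd p := by
  classical
  rw [two_colorable_iff_forall_loop_even] at h
  have hex : ∃ l, ∃ (u : V) (p : G.Walk u u), Odd p.length ∧ p.length = l := by
    push Not at h
    obtain ⟨u, p, hp⟩ := h
    exact ⟨_, u, p, Nat.not_even_iff_odd.1 hp, rfl⟩
  obtain ⟨u, p, hp, hl⟩ := Nat.find_spec hex
  exact ⟨u, p, hp, fun w q hq => hl ▸ Nat.find_min' hex ⟨w, q, hq, rfl⟩⟩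

lemma IsShortestOdd.five_le {V : Type*} {G : SimpleGraph V} {u : V} {p : G.Walk u u}
    (hp : IsShortestOdd p) (hG : ∀ x y z, G.Adj x y → G.Adj y z → ¬ G.Adj x z) :
    5 ≤ p.length := by
  by_contra! h
  have hodd := Nat.odd_iff.1 hp.odd
  have hend : p.getVert p.length = p.getVert 0 := by simp
  have h13 : p.length = 1 ∨ p.length = 3 := by omega
  rcases h13 with h1 | h3
  · have := p.adj_getVert_succ (i := 0) (by omega)
    rw [zero_add, ← h1, hend] at this
    exact this.ne rfl
  · have a := p.adj_getVert_succ (i := 0) (by omega)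
    have b := p.adj_getVert_succ (i := 1) (by omega)
    have c := p.adj_getVert_succ (i := 2) (by omega)
    rw [show 2 + 1 = p.length by omega, hend] at c
    exact hG _ _ _ a b c.symm

/-- A walk `r` of even length between two positions of a shortest odd closed walk `p` closes the arc
of odd length to an odd closed walk, so the other arc, of even length, is no longer than `r`. -/
lemma IsShortestOdd.arcs {V : Type*} {G : SimpleGraph V} {u : V} {p : G.Walk u u}
    (hp : IsShortestOdd p) {i j k : ℕ} (hij : i ≤ j) (hj : j ≤ p.length)
    (r : G.Walk (p.getVert i) (p.getVert j)) (hr : r.length = k) (hk : Even k) :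
    (Odd (j - i) ∧ p.length ≤ j - i + k) ∨ (Even (j - i) ∧ j - i ≤ k) := by
  obtain ⟨q, hq⟩ := exists_walk_getVert p hij hj
  rcases Nat.even_or_odd (j - i) with he | ho
  · right
    refine ⟨he, ?_⟩
    obtain ⟨q1, hq1⟩ := exists_walk_getVert p (Nat.zero_le i) (hij.trans hj)
    obtain ⟨q2, hq2⟩ := exists_walk_getVert p hj le_rfl
    have hend : p.getVert p.length = p.getVert 0 := by simp
    have h1 := hp.le _ (((r.append q2).copy rfl hend).append q1)
    simp only [Walk.length_append, Walk.length_copy, hr, hq1, hq2] at h1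
    have hodd := hp.odd
    rw [Nat.odd_iff] at h1 hodd
    rw [Nat.even_iff] at he hk
    have := h1 (by omega)
    omega
  · left
    refine ⟨ho, ?_⟩
    have h1 := hp.le _ (q.append r.reverse)
    simp only [Walk.length_append, Walk.length_reverse, hr, hq] at h1
    exact h1 (ho.add_even hk)

lemma IsShortestOdd.injective {V : Type*} {G : SimpleGraph V} {u : V} {p : G.Walk u u}
    (hp : IsShortestOdd p) : Function.Injective fun i : Fin p.length => p.getVert i := by
  have key : ∀ i j, i < j → j < p.length → p.getVert i ≠ p.getVert j := by
    intro i j hij hj h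
    rcases hp.arcs hij.le hj.le (Walk.nil.copy rfl h) (by simp) (k := 0) (by simp) with h | h
    · have := h.2
      omega
    · omega
  intro i j hij
  rcases lt_trichotomy i.val j.val with h | h | h
  · exact absurd hij (key _ _ h j.2)
  · exact Fin.ext h
  · exact absurd hij.symm (key _ _ h i.2)

/-- Two neighbours of `x` on a shortest odd closed walk are at distance two along it, and its length
is not six, so there are no three of them. -/
lemma IsShortestOdd.degInto_le_two {V : Type*} {G : SimpleGraph V} {u : V} {p : G.Walk u u}
    (hp : IsShortestOdd p) (h5 : 5 ≤ p.length) (x : V) :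
    degInto G (fun i : Fin p.length => p.getVert i) x ≤ 2 := by
  classical
  have hodd := Nat.odd_iff.1 hp.odd
  have key : ∀ i j, i < j → j < p.length → G.Adj x (p.getVert i) → G.Adj x (p.getVert j) →
      j = i + 2 ∨ j + 2 = i + p.length := by
    intro i j hij hj hi hj'
    rcases hp.arcs hij.le hj.le (.cons hi.symm (.cons hj' .nil)) rfl (by simp) with h | h
    · rw [Nat.odd_iff] at h
      simp only [Walk.length_cons, Walk.length_nil] at h
      omega
    · rw [Nat.even_iff] at h
      simp only [Walk.length_cons, Walk.length_nil] at h
      omega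
  have key' : ∀ i j : Fin p.length, i ≠ j → G.Adj x (p.getVert i) → G.Adj x (p.getVert j) →
      (j.val = i + 2 ∨ j.val + 2 = i + p.length) ∨ (i.val = j + 2 ∨ i.val + 2 = j + p.length) := by
    intro i j hij hi hj
    rcases lt_or_gt_of_ne (fun h => hij (Fin.ext h)) with h | h
    · exact Or.inl (key _ _ h j.2 hi hj)
    · exact Or.inr (key _ _ h i.2 hj hi)
  by_contra! h
  rw [degInto, Finset.two_lt_card_iff] at h
  obtain ⟨i, j, k, hi, hj, hk, hij, hik, hjk⟩ := h
  simp only [Finset.mem_filter, Finset.mem_univ, true_and] at hi hj hk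
  have h1 := key' i j hij hi hj
  have h2 := key' i k hik hi hk
  have h3 := key' j k hjk hj hk
  omega

/-- A triangle-free non-bipartite graph with at least `(n-1)²/4` edges has a five-cycle to which
almost all other vertices have two neighbours, and outside of which it is almost a balanced
complete bipartite graph. -/
lemma exists_five_cycle {V : Type*} [Fintype V] {G : SimpleGraph V}
    (hG : ∀ x y z, G.Adj x y → G.Adj y z → ¬ G.Adj x z) (hcol : ¬ G.Colorable 2)
    (he : (Fintype.card V - 1) ^ 2 ≤ 4 * G.edgeSet.ncard) :
    ∃ f : Fin 5 → V, Function.Injective f ∧ (∀ i, G.Adj (f i) (f (i + 1))) ∧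
      ∀ [Fintype ↥(Set.range f)ᶜ], Fintype.card V = Fintype.card ↥(Set.range f)ᶜ + 5 ∧
      Fintype.card ↥(Set.range f)ᶜ ^ 2 + 8 * Fintype.card ↥(Set.range f)ᶜ ≤
        4 * ∑ w : ↥(Set.range f)ᶜ, degInto G f w + 4 * (outside G f).edgeSet.ncard + 4 := by
  classical
  obtain ⟨u, p, hp⟩ := exists_isShortestOdd hcol
  have h5 := hp.five_le hG
  have hinj := hp.injective
  have hdeg := hp.degInto_le_two h5
  have hodd := Nat.odd_iff.1 hp.odd
  have hend : p.getVert p.length = p.getVert 0 := by simp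
  have hadj : ∀ i, i < p.length → G.Adj (p.getVert i) (p.getVert (i + 1)) := fun i hi =>
    p.adj_getVert_succ hi
  have main : ∀ l, l = p.length → ∃ f : Fin l → V, Function.Injective f ∧
      (∀ x, degInto G f x ≤ 2) ∧ ∀ i : Fin l, f i = p.getVert i := by
    rintro l rfl
    exact ⟨_, hinj, hdeg, fun _ => rfl⟩
  obtain ⟨l, hl⟩ : ∃ l, l = p.length := ⟨_, rfl⟩
  obtain ⟨f, finj, fdeg, hf⟩ := main l hl
  have hcard : ∀ [Fintype ↥(Set.range f)ᶜ],
      Fintype.card V = Fintype.card ↥(Set.range f)ᶜ + l := by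
    intro _
    have := sum_eq_sum_add_sum_compl_range finj (fun _ => 1)
    simp only [Finset.sum_const, Finset.card_univ, smul_eq_mul, mul_one, Fintype.card_fin] at this
    omega
  have hcyc : ∑ i, degInto G f (f i) ≤ 2 * l := by
    refine le_trans (Finset.sum_le_card_nsmul _ _ 2 fun i _ => fdeg _) ?_
    simp [mul_comm]
  have hl5 : l = 5 := by
    by_contra hne
    -- `l + 2m + m²/4` is less than `(m + l - 1)²/4` for `l ≥ 7`
    have hl7 : 7 ≤ l := by omega
    have h1 := two_mul_ncard_edgeSet_eq finj G
    have h2 : ∑ w : ↥(Set.range f)ᶜ, degInto G f w ≤ 2 * Fintype.card ↥(Set.range f)ᶜ := by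
      refine le_trans (Finset.sum_le_card_nsmul _ _ 2 fun i _ => fdeg _) ?_
      simp [mul_comm]
    have h3 : 4 * (outside G f).edgeSet.ncard ≤ Fintype.card ↥(Set.range f)ᶜ ^ 2 :=
      four_mul_ncard_edgeSet_le (cliqueFree_three_of_triangleFree fun x y z => hG x y z)
    rw [hcard, show Fintype.card ↥(Set.range f)ᶜ + l - 1 =
      Fintype.card ↥(Set.range f)ᶜ + (l - 1) by omega] at he
    obtain ⟨t, ht⟩ : ∃ t, l = t + 7 := ⟨l - 7, by omega⟩
    rw [show l - 1 = t + 6 by omega] at he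
    generalize Fintype.card ↥(Set.range f)ᶜ = m at *
    have h4 : 4 * G.edgeSet.ncard ≤ 4 * (t + 7) + 8 * m + m ^ 2 := by omega
    have h5 : 4 * (t + 7) + 8 * m + m ^ 2 < (m + (t + 6)) ^ 2 := by nlinarith [Nat.zero_le (m * t)]
    omega
  clear main
  subst hl5
  refine ⟨f, finj, ?_, ?_⟩
  · have hs : ∀ i : Fin 5, G.Adj (f i) (f (i + 1)) := by
      intro i
      rw [hf, hf]
      by_cases hi : i = 4
      · subst hi
        have := hadj 4 (by omega)
        rw [show 4 + 1 = p.length by omega, hend] at this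
        exact this
      · have hv : ((i + 1 : Fin 5) : ℕ) = i + 1 := by revert i; decide
        rw [hv]
        exact hadj i (by omega)
    exact hs
  · intro inst
    have hc : Fintype.card V = @Fintype.card _ inst + 5 := @hcard inst
    refine ⟨hc, ?_⟩
    have h1 := @two_mul_ncard_edgeSet_eq _ _ _ _ _ finj inst G
    rw [hc, show Fintype.card ↥(Set.range f)ᶜ + 5 - 1 =
      Fintype.card ↥(Set.range f)ᶜ + 4 by omega] at he
    have h2 : 4 * G.edgeSet.ncard ≤ 20 + 4 * ∑ w : ↥(Set.range f)ᶜ, degInto G f w +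
      4 * (outside G f).edgeSet.ncard := by omega
    have h3 := he.trans h2
    have h4 : (Fintype.card ↥(Set.range f)ᶜ + 4) ^ 2 =
      Fintype.card ↥(Set.range f)ᶜ ^ 2 + 8 * Fintype.card ↥(Set.range f)ᶜ + 16 := by ring
    exact Nat.le_of_add_le_add_right (b := 16) (by linarith)

/-! ### Vertices attached to a five-cycle -/

/-- `x` has the same neighbours on the five-cycle `f` as the vertex `f j`; the indices `Fin 5` are
added modulo five. -/
def IsType {V : Type*} (G : SimpleGraph V) (f : Fin 5 → V) (x : V) (j : Fin 5) : Prop :=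
  ∀ k, G.Adj x (f k) ↔ k = j + 1 ∨ k + 1 = j

section FiveCycle

variable {V : Type*} {G : SimpleGraph V} {f : Fin 5 → V}

lemma isType_self (hG : ∀ x y z, G.Adj x y → G.Adj y z → ¬ G.Adj x z)
    (hf : ∀ i, G.Adj (f i) (f (i + 1))) (j : Fin 5) : IsType G f (f j) j := by
  intro k
  constructor
  · intro h
    by_contra hne
    have hk : k = j ∨ k = j + 1 + 1 ∨ j = k + 1 + 1 := by
      clear * - hne; revert j k; decide
    rcases hk with rfl | rfl | rfl
    · exact h.ne rfl
    · exact hG _ _ _ (hf j) (hf (j + 1)) h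
    · exact hG _ _ _ (hf k) (hf (k + 1)) h.symm
  · rintro (rfl | rfl)
    · exact hf j
    · exact (hf k).symm

lemma ne_add_two (hG : ∀ x y z, G.Adj x y → G.Adj y z → ¬ G.Adj x z)
    (hf : ∀ i, G.Adj (f i) (f (i + 1))) (j : Fin 5) : f j ≠ f (j + 2) := by
  intro h
  have h1 := (isType_self hG hf j (j + 2 + 1)).symm.trans (h ▸ isType_self hG hf (j + 2) (j + 2 + 1))
  clear * - h1
  revert j; decide

lemma IsType.neg {x : V} {j : Fin 5} (h : IsType G f x j) : IsType G (fun i => f (-i)) x (-j) := by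
  intro k
  rw [h]
  clear h; revert j k; decide

lemma adj_neg (hf : ∀ i, G.Adj (f i) (f (i + 1))) (i : Fin 5) :
    G.Adj (f (-i)) (f (-(i + 1))) := by
  have := (hf (-(i + 1))).symm
  have he : -(i + 1) + 1 = -i := by clear * -; revert i; decide
  rwa [he] at this

lemma range_neg (f : Fin 5 → V) : Set.range (fun i => f (-i)) = Set.range f := by
  ext x
  constructor
  · rintro ⟨i, rfl⟩; exact ⟨_, rfl⟩
  · rintro ⟨i, rfl⟩; exact ⟨-i, by simp⟩

lemma IsType.of_adj (hG : ∀ x y z, G.Adj x y → G.Adj y z → ¬ G.Adj x z) {x y : V} {i j : Fin 5}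
    (hx : IsType G f x i) (hy : IsType G f y j) (hxy : G.Adj x y) : j = i + 1 ∨ j + 1 = i := by
  have h : ∀ k, ¬ ((k = i + 1 ∨ k + 1 = i) ∧ (k = j + 1 ∨ k + 1 = j)) := by
    rintro k ⟨h1, h2⟩
    exact hG _ _ _ hxy ((hy k).2 h2) ((hx k).2 h1)
  clear * - h; revert i j; decide

/-- A set of pairwise non-consecutive vertices of the five-cycle has at most two elements, and two
such vertices are the neighbours of a third. -/
lemma card_le_two_of_forall_succ_notMem : ∀ s : Finset (Fin 5), (∀ i ∈ s, i + 1 ∉ s) →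
    s.card ≤ 2 ∧ (s.card = 2 → ∃ j, ∀ k, k ∈ s ↔ k = j + 1 ∨ k + 1 = j) := by
  decide

lemma degInto_five_cycle_le_two (hG : ∀ x y z, G.Adj x y → G.Adj y z → ¬ G.Adj x z)
    (hf : ∀ i, G.Adj (f i) (f (i + 1))) (x : V) :
    degInto G f x ≤ 2 ∧ (degInto G f x = 2 → ∃ j, IsType G f x j) := by
  classical
  have h := card_le_two_of_forall_succ_notMem (Finset.univ.filter fun i => G.Adj x (f i)) (by
    intro i hi hi'
    simp only [Finset.mem_filter, Finset.mem_univ, true_and] at hi hi'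
    exact hG _ _ _ hi (hf i) hi')
  simp only [Finset.mem_filter, Finset.mem_univ, true_and] at h
  refine ⟨?_, ?_⟩
  · unfold degInto; convert h.1
  · intro h2
    refine h.2 ?_
    unfold degInto at h2; convert h2

/-- If every vertex looks like a vertex of the five-cycle, a vertex `w` looking like `f i` has its
neighbourhood contained in that of `f i`. For the two to lie on an induced path with a third vertex,
`w` has to miss some neighbour of `f i`. -/
lemma exists_missing_of_isType (hM : TriplesOnMonophonic G) (hf : ∀ i, G.Adj (f i) (f (i + 1)))
    (hT : ∀ x, x ∉ Set.range f → ∃ j, IsType G f x j) {w : V} {i : Fin 5}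
    (hw : w ∉ Set.range f) (hwi : IsType G f w i) :
    ∃ p q, G.Adj w p ∧ q ∉ Set.range f ∧ q ≠ w ∧ ¬ G.Adj w q ∧ G.Adj (f i) q ∧
      ¬ G.Adj p (f (i + 2)) ∧ ∃ r, G.Adj q r ∧ r ≠ f i ∧ ¬ G.Adj p r := by
  have hG := hM.cliqueFree_three
  have hself := isType_self hG hf
  have hT' : ∀ x, ∃ j, IsType G f x j := by
    intro x
    by_cases hx : x ∈ Set.range f
    · obtain ⟨k, rfl⟩ := hx
      exact ⟨k, hself k⟩
    · exact hT x hx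
  have hsub : ∀ x, G.Adj w x → G.Adj (f i) x := by
    intro x hx
    obtain ⟨j, hj⟩ := hT' x
    have := hwi.of_adj hG hj hx
    rw [G.adj_comm, hj]
    clear * - this; revert i j; decide
  have hne : w ≠ f i := fun h => hw ⟨i, h.symm⟩
  have hne' : w ≠ f (i + 2) := fun h => hw ⟨_, h.symm⟩
  have hne2 := ne_add_two hG hf i
  have hnz : ¬ G.Adj w (f (i + 2)) := by
    rw [hwi]; clear * -; revert i; decide
  obtain ⟨p, q, hwp, hvq, hwq, hqw, hrest⟩ :=
    hM.path_of_neighbors_subset hne hne2 hne' hnz hsub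
  have hq : q ∉ Set.range f := by
    rintro ⟨k, rfl⟩
    rw [hself i] at hvq
    exact hwq ((hwi k).2 hvq)
  refine ⟨p, q, hwp, hq, hqw, hwq, hvq, ?_⟩
  rcases hrest with rfl | ⟨h1, h2⟩
  · exact absurd ⟨_, rfl⟩ hq
  · exact ⟨h1, h2⟩

/-- With only two vertices outside of the five-cycle, the second one is forced into a position
that is not symmetric under reflection of the cycle. -/
lemma isType_eq_add_one (hM : TriplesOnMonophonic G) (hf : ∀ i, G.Adj (f i) (f (i + 1)))
    {w q : V} {i j : Fin 5} (hw : w ∉ Set.range f) (hwi : IsType G f w i) (hqj : IsType G f q j)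
    (hall : ∀ x, x ∉ Set.range f → x = w ∨ x = q) : j = i + 1 := by
  have hG := hM.cliqueFree_three
  have hself := isType_self hG hf
  have hT : ∀ x, x ∉ Set.range f → ∃ j, IsType G f x j := by
    intro x hx
    rcases hall x hx with rfl | rfl
    exacts [⟨_, hwi⟩, ⟨_, hqj⟩]
  obtain ⟨p, q', hwp, hq', hq'w, hwq', hvq', hpz, r, hqr, hri, hpr⟩ :=
    exists_missing_of_isType hM hf hT hw hwi
  have hqq : q' = q := (hall q' hq').resolve_left hq'w
  subst hqq
  have hp : p ∈ Set.range f := by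
    by_contra hp
    rcases hall p hp with rfl | rfl
    · exact hwp.ne rfl
    · exact hwq' hwp
  obtain ⟨k, rfl⟩ := hp
  have hr : r ∈ Set.range f := by
    by_contra hr
    rcases hall r hr with rfl | rfl
    · exact hwq' hqr.symm
    · exact hqr.ne rfl
  obtain ⟨l, rfl⟩ := hr
  have hli : l ≠ i := fun h => hri (h ▸ rfl)
  rw [hwi] at hwp
  rw [hself] at hpz hpr
  rw [G.adj_comm, hqj] at hvq'
  rw [hqj] at hqr
  clear * - hwp hpz hpr hvq' hqr hli
  revert i j k l
  decide

/-- Not all vertices outside of the five-cycle look like vertices of the cycle: each of them would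
miss a vertex of a neighbouring type, which costs more edges than are available. -/
lemma false_of_forall_isType [Fintype V] [Fintype ↥(Set.range f)ᶜ]
    (hM : TriplesOnMonophonic G) (hf : ∀ i, G.Adj (f i) (f (i + 1)))
    (hT : ∀ x, x ∉ Set.range f → ∃ j, IsType G f x j)
    (hpos : 0 < Fintype.card ↥(Set.range f)ᶜ)
    (he : Fintype.card ↥(Set.range f)ᶜ ^ 2 ≤ 4 * (outside G f).edgeSet.ncard + 4) : False := by
  classical
  have hG := hM.cliqueFree_three
  have hself := isType_self hG hf
  choose T hT' using fun x : ↥(Set.range f)ᶜ => hT x.1 x.2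
  -- the blow-up of the five-cycle according to the types
  let H : SimpleGraph ↥(Set.range f)ᶜ :=
    { Adj := fun x y => T y = T x + 1 ∨ T y + 1 = T x
      symm := ⟨fun x y h => by tauto⟩
      loopless := ⟨fun x h => by
        have : ∀ i : Fin 5, ¬ (i = i + 1 ∨ i + 1 = i) := by decide
        exact this _ h⟩ }
  have hH : ∀ x y z, H.Adj x y → H.Adj y z → ¬ H.Adj x z := by
    intro x y z
    change (T y = T x + 1 ∨ T y + 1 = T x) → (T z = T y + 1 ∨ T z + 1 = T y) →
      ¬ (T z = T x + 1 ∨ T z + 1 = T x)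
    generalize T x = a
    generalize T y = b
    generalize T z = c
    revert a b c; decide
  have hle : ∀ x y, (outside G f).Adj x y → H.Adj x y := fun x y hxy =>
    (hT' x).of_adj hG (hT' y) hxy
  have hmiss : ∀ w : ↥(Set.range f)ᶜ, ∃ q, q ≠ w ∧ ¬ (outside G f).Adj w q ∧ H.Adj w q := by
    intro w
    obtain ⟨p, q, -, hq, hqw, hwq, hvq, -⟩ := exists_missing_of_isType hM hf hT w.2 (hT' w)
    refine ⟨⟨q, hq⟩, fun h => hqw (congrArg Subtype.val h), hwq, ?_⟩
    exact (hself (T w)).of_adj hG (hT' ⟨q, hq⟩) hvq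
  -- every vertex has larger degree in `H` than in `outside G f`
  have hcount : 2 * (outside G f).edgeSet.ncard + Fintype.card ↥(Set.range f)ᶜ ≤
      2 * H.edgeSet.ncard := by
    rw [two_mul_ncard_edgeSet, two_mul_ncard_edgeSet, ← Finset.card_univ, Finset.card_eq_sum_ones,
      ← Finset.sum_add_distrib]
    refine Finset.sum_le_sum fun w _ => ?_
    obtain ⟨q, -, h1, h2⟩ := hmiss w
    rw [Nat.add_one_le_iff]
    refine Finset.sum_lt_sum (fun y _ => ?_) ⟨q, Finset.mem_univ _, ?_⟩
    · by_cases hy : (outside G f).Adj w y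
      · rw [if_pos hy, if_pos (hle _ _ hy)]
      · rw [if_neg hy]; exact Nat.zero_le _
    · rw [if_neg h1, if_pos h2]; exact Nat.one_pos
  have hmantel := four_mul_ncard_edgeSet_le (cliqueFree_three_of_triangleFree hH)
  have hcard : Fintype.card ↥(Set.range f)ᶜ ≤ 2 := by omega
  obtain ⟨w⟩ := Fintype.card_pos_iff.1 hpos
  obtain ⟨q, hqw, -⟩ := hmiss w
  have hall : ∀ x, x ∉ Set.range f → x = w.1 ∨ x = q.1 := by
    intro x hx
    by_contra! h
    have : 2 < (Finset.univ : Finset ↥(Set.range f)ᶜ).card :=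
      Finset.two_lt_card_iff.2 ⟨⟨x, hx⟩, w, q, by simp, by simp, by simp,
        fun e => h.1 (congrArg Subtype.val e), fun e => h.2 (congrArg Subtype.val e), hqw.symm⟩
    rw [Finset.card_univ] at this
    omega
  have h1 := isType_eq_add_one hM hf w.2 (hT' w) (hT' q) hall
  have h2 := isType_eq_add_one hM (adj_neg hf) (by rw [range_neg]; exact w.2) (hT' w).neg
    (hT' q).neg (by rw [range_neg]; exact hall)
  rw [h1] at h2
  revert h2
  generalize T w = a
  revert a
  decide

/-- Exactly one vertex `w₀` outside of the five-cycle has a single neighbour `f i₀` on it, and the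
graph outside is complete bipartite (non-adjacency is transitive there, and the side of `w₀` is not
`{w₀}` if the other side has at least two vertices). -/
structure IsExceptional (G : SimpleGraph V) (f : Fin 5 → V) (w₀ : V) (i₀ : Fin 5) : Prop where
  notMem : w₀ ∉ Set.range f
  adj_iff : ∀ k, G.Adj w₀ (f k) ↔ k = i₀
  exists_isType : ∀ x, x ∉ Set.range f → x ≠ w₀ → ∃ j, IsType G f x j
  not_adj_trans : ∀ x y z, x ∉ Set.range f → y ∉ Set.range f → z ∉ Set.range f →
    ¬ G.Adj x y → ¬ G.Adj y z → ¬ G.Adj x z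
  exists_common : ∀ q r, q ∉ Set.range f → r ∉ Set.range f → q ≠ r → G.Adj w₀ q → G.Adj w₀ r →
    ∃ x, x ∉ Set.range f ∧ x ≠ w₀ ∧ G.Adj x q ∧ G.Adj x r

variable {w₀ q : V} {i₀ j : Fin 5}

lemma IsExceptional.neg (h : IsExceptional G f w₀ i₀) :
    IsExceptional G (fun i => f (-i)) w₀ (-i₀) where
  notMem := by rw [range_neg]; exact h.notMem
  adj_iff k := by rw [h.adj_iff]; clear h; revert k i₀; decide
  exists_isType x hx hxw := by
    rw [range_neg] at hx
    obtain ⟨j, hj⟩ := h.exists_isType x hx hxw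
    exact ⟨_, hj.neg⟩
  not_adj_trans := by rw [range_neg]; exact h.not_adj_trans
  exists_common := by rw [range_neg]; exact h.exists_common

/-- The neighbours of `w₀` outside of the five-cycle never have types at distance one, since any
two of them have a common neighbour with a type. -/
lemma IsExceptional.ne_of_adj (h : IsExceptional G f w₀ i₀)
    (hG : ∀ x y z, G.Adj x y → G.Adj y z → ¬ G.Adj x z) {y : V} {l : Fin 5}
    (hq : q ∉ Set.range f) (hwq : G.Adj w₀ q) (hqj : IsType G f q j)
    (hy : y ∉ Set.range f) (hwy : G.Adj w₀ y) (hyl : IsType G f y l) :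
    ¬ (l = j + 1 ∨ l + 1 = j) := by
  by_cases hqy : q = y
  · subst hqy
    have e1 := fun k => (hqj k).symm.trans (hyl k)
    clear * - e1
    revert l j; decide
  · obtain ⟨x, hx, hxw, hxq, hxy⟩ := h.exists_common q y hq hy hqy hwq hwy
    obtain ⟨t, ht⟩ := h.exists_isType x hx hxw
    have h1 := ht.of_adj hG hqj hxq
    have h2 := ht.of_adj hG hyl hxy
    clear * - h1 h2
    revert l j t; decide

/-- The neighbourhood of `q` contains that of the cycle vertex of its type; by
`IsExceptional.adj_five_cycle_of_adj` the two differ by `w₀` at most. -/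
lemma IsExceptional.adj_of_adj_five_cycle (h : IsExceptional G f w₀ i₀)
    (hG : ∀ x y z, G.Adj x y → G.Adj y z → ¬ G.Adj x z) (hf : ∀ i, G.Adj (f i) (f (i + 1)))
    (hq : q ∉ Set.range f) (hwq : G.Adj w₀ q) (hqj : IsType G f q j) :
    ∀ x, G.Adj (f j) x → G.Adj q x := by
  intro x hx
  by_cases hxf : x ∈ Set.range f
  · obtain ⟨k, rfl⟩ := hxf
    rw [isType_self hG hf] at hx
    exact (hqj k).2 hx
  · by_cases hxw : x = w₀
    · rw [hxw]; exact hwq.symm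
    · obtain ⟨t, ht⟩ := h.exists_isType x hxf hxw
      have h1 := (isType_self hG hf j).of_adj hG ht hx
      have h2 : ¬ G.Adj w₀ x := fun hwx => h.ne_of_adj hG hq hwq hqj hxf hwx ht h1
      by_contra h3
      exact h.not_adj_trans w₀ x q h.notMem hxf hq h2 (fun e => h3 e.symm) hwq

lemma IsExceptional.adj_five_cycle_of_adj (h : IsExceptional G f w₀ i₀)
    (hG : ∀ x y z, G.Adj x y → G.Adj y z → ¬ G.Adj x z) (hf : ∀ i, G.Adj (f i) (f (i + 1)))
    (hqj : IsType G f q j) : ∀ x, x ≠ w₀ → G.Adj q x → G.Adj (f j) x := by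
  intro x hxw hx
  by_cases hxf : x ∈ Set.range f
  · obtain ⟨k, rfl⟩ := hxf
    rw [isType_self hG hf]
    exact (hqj k).1 hx
  · obtain ⟨t, ht⟩ := h.exists_isType x hxf hxw
    have h1 := hqj.of_adj hG ht hx
    rw [G.adj_comm, ht]
    clear * - h1
    revert t j; decide

/-- If `w₀` is attached to the cycle vertex of the type of its neighbour `q`, then `q` and that vertex
are twins, and no induced path runs through them and a vertex adjacent to neither. -/
lemma IsExceptional.ne_type (h : IsExceptional G f w₀ i₀) (hM : TriplesOnMonophonic G)
    (hf : ∀ i, G.Adj (f i) (f (i + 1))) (hq : q ∉ Set.range f) (hwq : G.Adj w₀ q)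
    (hqj : IsType G f q j) : i₀ ≠ j := by
  rintro rfl
  have hG := hM.cliqueFree_three
  have hsub : ∀ x, G.Adj q x → G.Adj (f i₀) x := by
    intro x hx
    by_cases hxw : x = w₀
    · rw [hxw, G.adj_comm, h.adj_iff]
    · exact h.adj_five_cycle_of_adj hG hf hqj x hxw hx
  have hnz : ¬ G.Adj q (f (i₀ + 2)) := by
    rw [hqj]; clear * -; revert i₀; decide
  obtain ⟨p, q', -, hvq, hwq', -⟩ := hM.path_of_neighbors_subset
    (fun e => hq ⟨i₀, e.symm⟩) (ne_add_two hG hf i₀) (fun e => hq ⟨_, e.symm⟩) hnz hsub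
  exact hwq' (h.adj_of_adj_five_cycle hG hf hq hwq hqj _ hvq)

/-- If `w₀` is attached at distance two from the vertex `f j` of the type of its neighbour `q`,
then `f j`, `q` and `f (j + 2)` lie on no common induced path. -/
lemma IsExceptional.add_two_ne (h : IsExceptional G f w₀ i₀) (hM : TriplesOnMonophonic G)
    (hf : ∀ i, G.Adj (f i) (f (i + 1))) (hq : q ∉ Set.range f) (hwq : G.Adj w₀ q)
    (hqj : IsType G f q j) : i₀ + 2 ≠ j := by
  intro hij
  have hG := hM.cliqueFree_three
  have hself := isType_self hG hf
  have hnz : ¬ G.Adj (f j) (f (j + 2)) := by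
    rw [hself]; clear * -; revert j; decide
  have hwj : ¬ G.Adj w₀ (f j) := by
    rw [h.adj_iff]; clear * - hij; revert j i₀; decide
  obtain ⟨p, q', hjp, hqq', hjq', -, hrest⟩ := hM.path_of_neighbors_subset
    (fun e => hq ⟨j, e⟩) (fun e => hq ⟨_, e.symm⟩) (ne_add_two hG hf j) hnz
    (h.adj_of_adj_five_cycle hG hf hq hwq hqj)
  have hq'w : q' = w₀ := by
    by_contra hne
    exact hjq' (h.adj_five_cycle_of_adj hG hf hqj q' hne hqq')
  subst hq'w
  rcases hrest with rfl | ⟨hpz, r, hwr, hrq, hpr⟩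
  · exact h.notMem ⟨_, rfl⟩
  by_cases hpf : p ∈ Set.range f
  · obtain ⟨k, rfl⟩ := hpf
    rw [hself] at hjp hpz
    by_cases hrf : r ∈ Set.range f
    · obtain ⟨l, rfl⟩ := hrf
      rw [h.adj_iff] at hwr
      rw [hself] at hpr
      clear * - hij hjp hpz hwr hpr
      revert i₀ j k l; decide
    · obtain ⟨l, hl⟩ := h.exists_isType r hrf hwr.ne'
      have h1 := h.ne_of_adj hG hq hwq hqj hrf hwr hl
      have h2 : ¬ G.Adj r (f i₀) := fun e => hG _ _ _ hwr e ((h.adj_iff i₀).2 rfl)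
      rw [hl] at h2
      rw [G.adj_comm, hl] at hpr
      have hkj : k + 1 = j := by
        clear * - hjp hpz; revert j k; decide
      subst hkj
      clear * - hij hpr h1 h2
      revert i₀ k l; decide
  · have hpw : p ≠ q' := by
      rintro rfl
      exact hjq' hjp
    obtain ⟨t, ht⟩ := h.exists_isType p hpf hpw
    have h1 := (hself j).of_adj hG ht hjp
    have h2 : ¬ G.Adj q' p := fun hwp => h.ne_of_adj hG hq hwq hqj hpf hwp ht h1
    rw [ht] at hpz
    by_cases hrf : r ∈ Set.range f
    · obtain ⟨l, rfl⟩ := hrf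
      rw [h.adj_iff] at hwr
      rw [ht] at hpr
      clear * - hij h1 hpz hwr hpr
      revert i₀ j t l; decide
    · exact h.not_adj_trans q' p r h.notMem hpf hrf h2 hpr hwr

lemma IsExceptional.false (h : IsExceptional G f w₀ i₀) (hM : TriplesOnMonophonic G)
    (hf : ∀ i, G.Adj (f i) (f (i + 1))) (hq : q ∉ Set.range f) (hwq : G.Adj w₀ q) : False := by
  have hG := hM.cliqueFree_three
  obtain ⟨j, hqj⟩ := h.exists_isType q hq hwq.ne'
  have h1 := h.ne_type hM hf hq hwq hqj
  have h2 := h.add_two_ne hM hf hq hwq hqj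
  have h3 := h.neg.add_two_ne hM (adj_neg hf) (by rw [range_neg]; exact hq) hwq hqj.neg
  have h4 : ¬ G.Adj q (f i₀) := fun e => hG _ _ _ hwq e ((h.adj_iff i₀).2 rfl)
  rw [hqj] at h4
  clear * - h1 h2 h3 h4
  revert i₀ j; decide

end FiveCycle

/-- In a balanced complete bipartite graph, every vertex has a neighbour, and two neighbours of a
vertex have a further common neighbour. -/
lemma complete_bipartite_of_four_mul {W : Type*} [Fintype W] {H : SimpleGraph W}
    (hH : H.CliqueFree (2 + 1)) (he : 4 * H.edgeSet.ncard = Fintype.card W ^ 2) :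
    (∀ x y z, ¬ H.Adj x y → ¬ H.Adj y z → ¬ H.Adj x z) ∧ (∀ x, ∃ y, H.Adj x y) ∧
      ∀ w q r, q ≠ r → H.Adj w q → H.Adj w r → ∃ x, x ≠ w ∧ H.Adj x q ∧ H.Adj x r := by
  obtain ⟨φ⟩ := nonempty_iso_turanGraph_of_four_mul hH he.ge
  have hadj : ∀ x y, H.Adj x y ↔ (φ x).val % 2 ≠ (φ y).val % 2 := by
    intro x y
    rw [← φ.map_adj_iff, turanGraph_adj]
  have heven : Fintype.card W % 2 = 0 := by
    by_contra hne
    obtain ⟨k, hk⟩ : ∃ k, Fintype.card W = 2 * k + 1 := ⟨Fintype.card W / 2, by omega⟩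
    rw [hk] at he
    have : (2 * k + 1) ^ 2 = 4 * (k * k + k) + 1 := by ring
    omega
  have hsurj : ∀ i, i < Fintype.card W → ∃ x, (φ x).val = i := fun i hi =>
    ⟨φ.symm ⟨i, hi⟩, by simp⟩
  refine ⟨?_, ?_, ?_⟩
  · intro x y z
    simp only [hadj]
    omega
  · intro x
    have := (φ x).isLt
    by_cases h0 : (φ x).val % 2 = 0
    · obtain ⟨y, hy⟩ := hsurj ((φ x).val + 1) (by omega)
      exact ⟨y, by rw [hadj]; omega⟩
    · obtain ⟨y, hy⟩ := hsurj ((φ x).val - 1) (by omega)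
      exact ⟨y, by rw [hadj]; omega⟩
  · intro w q r hqr hwq hwr
    rw [hadj] at hwq hwr
    have hne : (φ q).val ≠ (φ r).val := fun h => hqr (φ.injective (Fin.ext h))
    have h1 := (φ q).isLt
    have h2 := (φ r).isLt
    by_cases hw : (φ w).val < 2
    · obtain ⟨x, hx⟩ := hsurj ((φ w).val + 2) (by omega)
      refine ⟨x, ?_, ?_, ?_⟩
      · rintro rfl; omega
      · rw [hadj]; omega
      · rw [hadj]; omega
    · have := (φ w).isLt
      obtain ⟨x, hx⟩ := hsurj ((φ w).val - 2) (by omega)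
      refine ⟨x, ?_, ?_, ?_⟩
      · rintro rfl; omega
      · rw [hadj]; omega
      · rw [hadj]; omega

/-- A non-bipartite graph on `n ≥ 6` vertices with mp-number two has fewer than `(n-1)²/4`
edges. -/
theorem TriplesOnMonophonic.colorable_two {V : Type*} [Fintype V] {G : SimpleGraph V}
    (hM : TriplesOnMonophonic G) (hn : 6 ≤ Fintype.card V)
    (he : (Fintype.card V - 1) ^ 2 ≤ 4 * G.edgeSet.ncard) : G.Colorable 2 := by
  classical
  have hG := hM.cliqueFree_three
  by_contra hcol
  obtain ⟨f, finj, hf, hrest⟩ := exists_five_cycle hG hcol he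
  obtain ⟨hcard, hcount⟩ := hrest
  have hdeg := degInto_five_cycle_le_two hG hf
  have hH : (outside G f).CliqueFree (2 + 1) :=
    cliqueFree_three_of_triangleFree fun x y z => hG x y z
  have hmantel := four_mul_ncard_edgeSet_le hH
  by_cases hall : ∀ w : ↥(Set.range f)ᶜ, degInto G f w = 2
  · refine false_of_forall_isType hM hf (fun x hx => (hdeg x).2 (hall ⟨x, hx⟩)) (by omega) ?_
    rw [Finset.sum_congr rfl fun w _ => hall w, Finset.sum_const, Finset.card_univ,
      smul_eq_mul] at hcount
    omega
  · push Not at hall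
    obtain ⟨w₀, hw₀⟩ := hall
    have hsplit := Finset.add_sum_erase Finset.univ (fun w : ↥(Set.range f)ᶜ => degInto G f w)
      (Finset.mem_univ w₀)
    have hle := (hdeg w₀).1
    have hcard' : (Finset.univ.erase w₀).card + 1 = Fintype.card ↥(Set.range f)ᶜ := by
      rw [Finset.card_erase_add_one (Finset.mem_univ _), Finset.card_univ]
    have hsum : ∑ w ∈ Finset.univ.erase w₀, degInto G f w ≤ (Finset.univ.erase w₀).card * 2 :=
      Finset.sum_le_card_nsmul _ _ 2 fun w _ => (hdeg w).1
    -- by `hcount` and Mantel's theorem, `w₀` accounts for all that may be missing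
    have h1 : degInto G f w₀ = 1 := by omega
    have h2 : ∀ w : ↥(Set.range f)ᶜ, w ≠ w₀ → degInto G f w = 2 := by
      intro w hw
      by_contra hne
      have : ∑ w ∈ Finset.univ.erase w₀, degInto G f w < ∑ w ∈ Finset.univ.erase w₀, 2 :=
        Finset.sum_lt_sum (fun w _ => (hdeg w).1)
          ⟨w, by simp [hw], lt_of_le_of_ne (hdeg w).1 hne⟩
      rw [Finset.sum_const, smul_eq_mul] at this
      omega
    have h3 : 4 * (outside G f).edgeSet.ncard = Fintype.card ↥(Set.range f)ᶜ ^ 2 := by omega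
    obtain ⟨htrans, hnbr, hcommon⟩ := complete_bipartite_of_four_mul hH h3
    rw [degInto, Finset.card_eq_one] at h1
    obtain ⟨i₀, hi₀⟩ := h1
    have hex : IsExceptional G f w₀ i₀ := by
      refine ⟨w₀.2, ?_, ?_, ?_, ?_⟩
      · intro k
        have := Finset.ext_iff.1 hi₀ k
        simpa using this
      · intro x hx hxw
        exact (hdeg x).2 (h2 ⟨x, hx⟩ fun e => hxw (congrArg Subtype.val e))
      · intro x y z hx hy hz
        exact htrans ⟨x, hx⟩ ⟨y, hy⟩ ⟨z, hz⟩
      · intro q r hq hr hqr h1 h2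
        obtain ⟨x, hx, hxq, hxr⟩ := hcommon w₀ ⟨q, hq⟩ ⟨r, hr⟩
          (fun e => hqr (congrArg Subtype.val e)) h1 h2
        exact ⟨x, x.2, fun e => hx (Subtype.ext e), hxq, hxr⟩
    obtain ⟨q, hq⟩ := hnbr w₀
    exact hex.false hM hf q.2 hq

/-! ### The extremal graphs -/

/-- Colour the larger class of a bipartition by `false`. -/
lemma exists_coloring_bool {V : Type*} [Fintype V] {G : SimpleGraph V} (h : G.Colorable 2) :
    ∃ c : V → Bool, (∀ u v, G.Adj u v → c u ≠ c v) ∧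
      (Finset.univ.filter (c · = true)).card ≤ (Finset.univ.filter (c · = false)).card := by
  classical
  have hb : ∃ c : V → Bool, ∀ u v, G.Adj u v → c u ≠ c v := by
    obtain ⟨c⟩ := h
    refine ⟨fun v => decide (c v = 0), fun u v huv => ?_⟩
    have := c.valid huv
    rw [Ne, decide_eq_decide]
    omega
  obtain ⟨c, hc⟩ := hb
  rcases le_total (Finset.univ.filter (c · = true)).card
    (Finset.univ.filter (c · = false)).card with hle | hle
  · exact ⟨c, hc, hle⟩
  · refine ⟨fun v => !c v, fun u v huv => by simpa using hc u v huv, ?_⟩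
    simpa using hle

/-- For graphs on `n ≥ 6` vertices, mp-number two and at least `⌈(n-1)²/4⌉` edges characterise the
near-complete bipartite graphs. -/
theorem mpNumber_eq_two_and_le_iff {V : Type*} [Fintype V] {G : SimpleGraph V}
    (hn : 6 ≤ Fintype.card V) :
    (mpNumber G = 2 ∧ ⌈((Fintype.card V : ℚ) - 1) ^ 2 / 4⌉₊ ≤ G.edgeSet.ncard) ↔
      ∃ c, IsNearCompleteBipartite G c := by
  rw [mpNumber_eq_two_iff G (by omega)]
  constructor
  · rintro ⟨hM, he⟩
    have he' : (Fintype.card V - 1) ^ 2 ≤ 4 * G.edgeSet.ncard := by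
      rw [Nat.ceil_le] at he
      have h1 : (((Fintype.card V - 1 : ℕ) : ℚ)) = (Fintype.card V : ℚ) - 1 := by
        rw [Nat.cast_sub (by omega)]; simp
      rw [← h1] at he
      have h2 : (((Fintype.card V - 1 : ℕ) : ℚ)) ^ 2 ≤ 4 * G.edgeSet.ncard := by linarith
      exact_mod_cast h2
    obtain ⟨c, hc, hle⟩ := exists_coloring_bool (hM.colorable_two hn he')
    exact ⟨c, hM.isNearCompleteBipartite hn hc hle he'⟩
  · rintro ⟨c, h⟩
    exact ⟨h.triplesOnMonophonic hn, h.ncard_edgeSet_eq.ge⟩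

lemma isNewCrossEdge_zero_one {n : ℕ} (hn : 2 ≤ n) :
    IsNewCrossEdge n 2 ⟨0, by omega⟩ ⟨1, by omega⟩ := by
  rw [isNewCrossEdge_two_iff]
  change 0 % 2 ≠ 1 % 2 ∧ 0 / 2 = 1 / 2 ∧ 0 / 2 < n / 2
  omega

lemma exists_isNearCompleteBipartite (n : ℕ) (hn : 2 ≤ n) :
    ∃ (G : SimpleGraph (Fin n)) (c : Fin n → Bool), IsNearCompleteBipartite G c := by
  rcases Nat.even_or_odd n with he | ho
  · exact ⟨_, _, isNearCompleteBipartite_tStar_sup_edge he (isNewCrossEdge_zero_one hn)⟩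
  · exact ⟨_, _, isNearCompleteBipartite_tStar ho⟩

lemma isGreatest_mpSizes_two {n : ℕ} (hn : 6 ≤ n) :
    IsGreatest (mpSizes n 2) ⌈((n : ℚ) - 1) ^ 2 / 4⌉₊ := by
  have hn' : 6 ≤ Fintype.card (Fin n) := by simpa using hn
  constructor
  · obtain ⟨G, c, h⟩ := exists_isNearCompleteBipartite n (by omega)
    refine ⟨G, ((mpNumber_eq_two_and_le_iff hn').2 ⟨c, h⟩).1, ?_⟩
    rw [h.ncard_edgeSet_eq, Fintype.card_fin]
  · rintro m ⟨G, hG, rfl⟩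
    by_contra! hlt
    obtain ⟨c, h⟩ := (mpNumber_eq_two_and_le_iff (G := G) hn').1
      ⟨hG, by rw [Fintype.card_fin]; exact hlt.le⟩
    rw [h.ncard_edgeSet_eq, Fintype.card_fin] at hlt
    exact lt_irrefl _ hlt

lemma mex_two {n : ℕ} (hn : 6 ≤ n) : mex n 2 = ⌈((n : ℚ) - 1) ^ 2 / 4⌉₊ :=
  (isGreatest_mpSizes_two hn).csSup_eq

lemma isMexExtremal_two_iff {V : Type*} [Fintype V] {G : SimpleGraph V}
    (hn : 6 ≤ Fintype.card V) : IsMexExtremal G 2 ↔ ∃ c, IsNearCompleteBipartite G c := by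
  rw [IsMexExtremal, Nat.card_eq_fintype_card, mex_two hn, ← mpNumber_eq_two_and_le_iff hn]
  constructor
  · rintro ⟨h1, h2⟩
    exact ⟨h1, h2.ge⟩
  · intro h
    obtain ⟨c, hc⟩ := (mpNumber_eq_two_and_le_iff hn).1 h
    exact ⟨h.1, hc.ncard_edgeSet_eq⟩

lemma isMexExtremal_two_iff_nonempty_iso {V W : Type*} [Fintype V] [Fintype W]
    {G : SimpleGraph V} {H : SimpleGraph W} {d : W → Bool} (hH : IsNearCompleteBipartite H d)
    (hn : 6 ≤ Fintype.card V) (hcard : Fintype.card V = Fintype.card W) :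
    IsMexExtremal G 2 ↔ Nonempty (G ≃g H) := by
  rw [isMexExtremal_two_iff hn]
  exact ⟨fun ⟨_, hc⟩ => hc.nonempty_iso hH hcard, fun ⟨φ⟩ => ⟨_, hH.of_iso φ⟩⟩

end MonoPos

theorem theorem3p6 (n : ℕ) (hn : 6 ≤ n) :
    IsGreatest (MonoPos.mpSizes n 2) (MonoPos.mex n 2) ∧
    MonoPos.mex n 2 = ⌈((n : ℚ) - 1) ^ 2 / 4⌉₊ ∧
    (Odd n → ∀ (V : Type*) [Fintype V] (G : SimpleGraph V), Fintype.card V = n →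
      (MonoPos.IsMexExtremal G 2 ↔ Nonempty (G ≃g MonoPos.tStar n 2))) ∧
    (Even n →
      (∃ v w : Fin n, MonoPos.IsNewCrossEdge n 2 v w) ∧
      ∀ v w : Fin n, MonoPos.IsNewCrossEdge n 2 v w →
        ∀ (V : Type*) [Fintype V] (G : SimpleGraph V), Fintype.card V = n →
          (MonoPos.IsMexExtremal G 2 ↔
            Nonempty (G ≃g MonoPos.tStar n 2 ⊔ SimpleGraph.edge v w))) := by
  refine ⟨?_, MonoPos.mex_two hn, ?_, ?_⟩
  · rw [MonoPos.mex_two hn]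
    exact MonoPos.isGreatest_mpSizes_two hn
  · intro ho V _ G hV
    exact MonoPos.isMexExtremal_two_iff_nonempty_iso (MonoPos.isNearCompleteBipartite_tStar ho)
      (by omega) (by rw [hV, Fintype.card_fin])
  · intro he
    refine ⟨⟨_, _, MonoPos.isNewCrossEdge_zero_one (by omega)⟩, ?_⟩
    intro v w hvw V _ G hV
    exact MonoPos.isMexExtremal_two_iff_nonempty_iso
      (MonoPos.isNearCompleteBipartite_tStar_sup_edge he hvw)
      (by omega) (by rw [hV, Fintype.card_fin])
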